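/- For a complex number $x$ and an integer $n\ge 0$ let $(x)_n=x(x+1)\cdots(x+n-1)$, and for complex $a$ let $(x)_a=\Gamma(x+a)/\Gamma(x)$, where $1/(x)_a=\Gamma(x)/\Gamma(x+a)$ is understood to be $0$ at the poles of $\Gamma(x+a)$. For complex $a\notin\{-1,-2,-3,\dots\}$ let $$f(a)=\sum_{n=0}^{\infty}\frac{(-1)^n}{2^{2n}}\,\frac{\left(a+\frac12\right)_n\left(a+\frac14\right)_n\left(a+\frac34\right)_n}{(a+1)_n^3}\,[20(n+a)+3].$$ This series converges absolutely, and the following hold. (i) For every complex $a$ with $\operatorname{Re} a>0$ the series on the right below converges absolutely and $$f(a)=16a\sum_{n=0}^{\infty}\frac{\left(\frac12\right)_n\left(a+\frac12\right)_n}{(a+1)_n(2a+1)_n}.$$ (ii) For every complex $a$ with $a\notin\{-1,-2,-3,\dots\}$ and $\cos\pi a\ne 0$ the series on the right below converges absolutely and $$f(a)=\frac{8}{\pi}\cdot\frac{4^a}{\cos\pi a}\cdot\frac{(1)_a^3}{\left(\frac12\right)_a\left(\frac14\right)_a\left(\frac34\right)_a}+\frac{48a^2}{2a-1}\sum_{n=0}^{\infty}\frac{1}{4^n}\,\frac{\left(a+\frac12\right)_n\left(2a+\frac12\right)_n}{(a+1)_n\left(\frac32-a\right)_n}.$$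 (iii) $f\left(\frac12\right)=16\ln 2$; $f(0)=\dfrac{8}{\pi}$; and $f$ is complex differentiable in a neighbourhood of $0$ and twice differentiable at $0$, with $$f'(0)=\frac{80}{\pi}\ln 2,\qquad f''(0)=\frac{8}{\pi}\left(100\ln^2 2-5\pi^2\right).$$ -/

import Mathlib

noncomputable section

namespace RamanujanExt

/-- The rising factorial `(x)_n = x (x + 1) ⋯ (x + n - 1)` with a natural number index. -/
def poch (x : ℂ) (n : ℕ) : ℂ := (ascPochhammer ℂ n).eval x

/-- The rising factorial `(x)_a = Γ(x + a) / Γ(x)` with a complex index. Where `Γ(x + a)` has a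
pole, `Complex.Gamma (x + a) = 0`, so that the quotient `1 / rising x a` takes the value `0` there,
which is the value of the entire function `a ↦ 1 / (x)_a = Γ(x) / Γ(x + a)`. -/
def rising (x a : ℂ) : ℂ := Complex.Gamma (x + a) / Complex.Gamma x

/-- The `n`-th term of the extended Ramanujan series. -/
def term (a : ℂ) (n : ℕ) : ℂ :=
  (-1) ^ n / 2 ^ (2 * n)
    * (poch (a + 1 / 2) n * poch (a + 1 / 4) n * poch (a + 3 / 4) n / poch (a + 1) n ^ 3)
    * (20 * (n + a) + 3)

/-- The extended Ramanujan series. -/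
def f (a : ℂ) : ℂ := ∑' n : ℕ, term a n

/-- The `n`-th term of the series in the first reduction. -/
def term₁ (a : ℂ) (n : ℕ) : ℂ :=
  poch (1 / 2) n * poch (a + 1 / 2) n / (poch (a + 1) n * poch (2 * a + 1) n)

/-- The `n`-th term of the series in the second reduction. -/
def term₂ (a : ℂ) (n : ℕ) : ℂ :=
  1 / 4 ^ n * (poch (a + 1 / 2) n * poch (2 * a + 1 / 2) n / (poch (a + 1) n * poch (3 / 2 - a) n))

end RamanujanExt

end

noncomputable section
namespace RamanujanExt
open Filter Topology

/-! All three series solve one inhomogeneous recurrence, F(a) = 20a + 3 + `ratio a` · F(a + 1). For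
`f` this is the splitting off of the first term. For `g₁` and `g₂` it comes from Wilf–Zeilberger
mates (`mate₁_sub_succ`, `mate₂_sub_succ`), which turn the defect into a telescoping sum with total
20a + 3. A difference D of two solutions then satisfies D(a) = `ratio a` · D(a + 1).

When Re a > 0, the ratio has modulus at most 1/4, while `f` and `g₁` grow at most linearly to the
right. Iteration forces `f = g₁` (`eq_zero_of_eq_ratio_mul`).

The function `g₂` has a pole at 1/2, and a homogeneous solution survives. Multiplication by `weight`
makes `f - g₂` antiperiodic, like 1/cos πa. The behaviour at 1/2 fixes the factor 8/π
(`product_half`). What is left, `quotient`, is holomorphic on a strip wider than a period, so it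
extends to an entire antiperiodic function of linear growth; such a function is affine, hence zero
(`eq_zero_of_antiperiodic_on_strip`). The recurrence carries the identity from the strip to all
admissible a.

At a = 1/2 the first reduction is the alternating harmonic series. Near 0, `g₂` contributes only in
second order, through the arcsine value π/6. The Gamma factor is expanded to second order with the
duplication and reflection formulas, so that no value of Γ' or Γ'' is needed (`hasJet_f`). -/

/-! ### Rising factorials, ratio tests and telescoping. -/

lemma poch_zero (x : ℂ) : poch x 0 = 1 := by simp [poch]

lemma poch_succ (x : ℂ) (n : ℕ) : poch x (n + 1) = poch x n * (x + n) := by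
  simp [poch, ascPochhammer_succ_eval]

lemma poch_succ_left (x : ℂ) (n : ℕ) : poch x (n + 1) = x * poch (x + 1) n := by
  simp [poch, ascPochhammer_succ_left, Polynomial.eval_comp]

lemma mul_poch_add_one (x : ℂ) (n : ℕ) : x * poch (x + 1) n = poch x n * (x + n) := by
  rw [← poch_succ_left, poch_succ]

lemma poch_ne_zero {x : ℂ} (hx : ∀ m : ℕ, x + m ≠ 0) (n : ℕ) : poch x n ≠ 0 := by
  induction n with
  | zero => simp [poch_zero]
  | succ n ih => rw [poch_succ]; exact mul_ne_zero ih (hx n)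

lemma norm_poch_le {x y : ℂ} {M : ℝ} (h : ∀ j : ℕ, ‖x + j‖ ≤ M * ‖y + j‖) (hM : 0 ≤ M) (n : ℕ) :
    ‖poch x n‖ ≤ M ^ n * ‖poch y n‖ := by
  induction n with
  | zero => simp [poch_zero]
  | succ n ih =>
    rw [poch_succ, poch_succ, norm_mul, norm_mul, pow_succ]
    calc _ ≤ (M ^ n * ‖poch y n‖) * (M * ‖y + n‖) := by gcongr; exact h n
      _ = _ := by ring

lemma norm_poch_div_le {x y : ℂ} {M : ℝ} (h : ∀ j : ℕ, ‖x + j‖ ≤ M * ‖y + j‖) (hM : 0 ≤ M)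
    (n : ℕ) : ‖poch x n / poch y n‖ ≤ M ^ n := by
  rw [norm_div]
  exact div_le_of_le_mul₀ (norm_nonneg _) (by positivity) (norm_poch_le h hM n)

lemma norm_le_norm_of_sq_le {z w : ℂ} (h : z.re ^ 2 + z.im ^ 2 ≤ w.re ^ 2 + w.im ^ 2) :
    ‖z‖ ≤ ‖w‖ := by
  rw [← sq_le_sq₀ (norm_nonneg _) (norm_nonneg _), Complex.sq_norm, Complex.sq_norm,
    Complex.normSq_apply, Complex.normSq_apply]
  linarith

lemma add_natCast_ne_zero_of_re_pos {x : ℂ} (hx : 0 < x.re) (m : ℕ) : x + m ≠ 0 := by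
  intro h
  have := congrArg Complex.re h
  simp at this
  have : (0 : ℝ) ≤ m := m.cast_nonneg
  linarith

lemma tendsto_add_div_add (x y : ℂ) :
    Tendsto (fun n : ℕ => (x + n) / (y + n)) atTop (𝓝 1) := by
  simpa using tendsto_add_mul_div_add_mul_atTop_nhds x y (1 : ℂ) (one_ne_zero)

lemma summable_of_ratio {u ρ : ℕ → ℂ} {ρ₀ : ℂ} (h : ∀ᶠ n in atTop, u (n + 1) = ρ n * u n)
    (hρ : Tendsto ρ atTop (𝓝 ρ₀)) (h₀ : ‖ρ₀‖ < 1) : Summable u := by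
  obtain ⟨s, hs, hs1⟩ := exists_between h₀
  refine summable_of_ratio_norm_eventually_le hs1 ?_
  filter_upwards [h, hρ.norm.eventually (gt_mem_nhds hs)] with n hn hn'
  rw [hn, norm_mul]
  gcongr

lemma summable_pow_mul_of_ratio {u ρ : ℕ → ℂ} {ρ₀ : ℂ}
    (h : ∀ n, u (n + 1) = ρ n * u n) (hρ : Tendsto ρ atTop (𝓝 ρ₀)) (h₀ : ‖ρ₀‖ < 1) (j : ℕ) :
    Summable (fun n : ℕ => (n : ℂ) ^ j * u n) := by
  refine summable_of_ratio (ρ := fun n => ((1 + n) / (0 + n)) ^ j * ρ n) (ρ₀ := ρ₀) ?_ ?_ h₀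
  · filter_upwards [eventually_gt_atTop 0] with n hn
    have : (n : ℂ) ≠ 0 := by exact_mod_cast hn.ne'
    rw [h]; push_cast; rw [zero_add, div_pow, add_comm 1 (n : ℂ)]; field_simp
  · simpa using ((tendsto_add_div_add 1 0).pow j).mul hρ

lemma tsum_sub_succ {V : ℕ → ℂ} (hs : Summable fun k => V k - V (k + 1))
    (hV : Tendsto V atTop (𝓝 0)) : ∑' k, (V k - V (k + 1)) = V 0 := by
  refine tendsto_nhds_unique hs.hasSum.tendsto_sum_nat ?_
  simp_rw [Finset.sum_range_sub']
  simpa using hV.const_sub (V 0)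

/-! ### Recurrence and growth of `f`. -/

/-- The ratio `(-1/4) (a+1/2) (a+1/4) (a+3/4) / (a+1)^3` of consecutive coefficients. -/
def ratio (a : ℂ) : ℂ := -(1 / 4) * ((a + 1 / 2) * (a + 1 / 4) * (a + 3 / 4)) / (a + 1) ^ 3

lemma term_succ (a : ℂ) (n : ℕ) : term a (n + 1) = ratio a * term (a + 1) n := by
  simp only [term, ratio, poch_succ_left]
  rw [show a + 1 / 2 + 1 = a + 1 + 1 / 2 by ring, show a + 1 / 4 + 1 = a + 1 + 1 / 4 by ring,
    show a + 3 / 4 + 1 = a + 1 + 3 / 4 by ring, pow_succ (-1 : ℂ), mul_add 2 n 1, pow_add]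
  push_cast
  simp only [mul_pow, div_eq_mul_inv, mul_inv]
  ring

lemma summable_term (a : ℂ) : Summable (term a) := by
  let c : ℕ → ℂ := fun n => (-1) ^ n / 2 ^ (2 * n)
    * (poch (a + 1 / 2) n * poch (a + 1 / 4) n * poch (a + 3 / 4) n / poch (a + 1) n ^ 3)
  let ρ : ℕ → ℂ := fun n => -(1 / 4) * (((a + 1 / 2) + n) / ((a + 1) + n) *
    (((a + 1 / 4) + n) / ((a + 1) + n)) * (((a + 3 / 4) + n) / ((a + 1) + n)))
  have h : ∀ n, c (n + 1) = ρ n * c n := by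
    intro n
    simp only [c, ρ, poch_succ]
    rw [pow_succ (-1 : ℂ), mul_add 2 n 1, pow_add]
    -- Inversion is multiplicative even at zero, so this identity needs no nonvanishing denominator.
    generalize a + 1 + (n : ℂ) = y
    simp only [mul_pow, div_eq_mul_inv, mul_inv]
    ring
  have hρ : Tendsto ρ atTop (𝓝 (-(1 / 4) * (1 * 1 * 1))) :=
    (((tendsto_add_div_add _ _).mul (tendsto_add_div_add _ _)).mul
      (tendsto_add_div_add _ _)).const_mul _
  have h0 : ‖(-(1 / 4) * (1 * 1 * 1) : ℂ)‖ < 1 := by norm_num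
  refine (((summable_pow_mul_of_ratio h hρ h0 0).mul_left (20 * a + 3)).add
    ((summable_pow_mul_of_ratio h hρ h0 1).mul_left 20)).congr fun n => ?_
  change _ = c n * (20 * (↑n + a) + 3)
  ring

lemma f_eq_add_ratio_mul (a : ℂ) : f a = 20 * a + 3 + ratio a * f (a + 1) := by
  rw [f, (summable_term a).tsum_eq_zero_add, f, ← tsum_mul_left]
  simp only [term_succ]
  simp [term, poch_zero]

lemma norm_ratio_le {a : ℂ} (ha : 0 ≤ a.re) : ‖ratio a‖ ≤ 1 / 4 := by
  have h0 : 0 < ‖a + 1‖ := norm_pos_iff.2 fun h => by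
    have := congrArg Complex.re h
    simp at this; linarith
  have h1 : ‖a + 1 / 2‖ ≤ ‖a + 1‖ := norm_le_norm_of_sq_le (by norm_num; nlinarith)
  have h2 : ‖a + 1 / 4‖ ≤ ‖a + 1‖ := norm_le_norm_of_sq_le (by norm_num; nlinarith)
  have h3 : ‖a + 3 / 4‖ ≤ ‖a + 1‖ := norm_le_norm_of_sq_le (by norm_num; nlinarith)
  rw [ratio, norm_div, norm_mul, norm_mul, norm_mul, norm_pow, div_le_iff₀ (by positivity)]
  have : ‖a + 1 / 2‖ * ‖a + 1 / 4‖ * ‖a + 3 / 4‖ ≤ ‖a + 1‖ * ‖a + 1‖ * ‖a + 1‖ := by gcongr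
  norm_num at this ⊢
  nlinarith

/-- Each quotient of rising factorials has modulus at most 1, because a + s + j is no farther from 0
than a + 1 + j in this half-plane. The bound serves both linear growth and locally uniform
convergence. -/
lemma norm_term_le {a : ℂ} (ha : -1 / 4 ≤ a.re) (n : ℕ) :
    ‖term a n‖ ≤ (1 / 4) ^ n * (20 * n + 23) * (1 + ‖a‖) := by
  have key : ∀ s : ℝ, 0 ≤ s → s ≤ 1 → ‖poch (a + s) n / poch (a + 1) n‖ ≤ 1 ∨ s < 1 / 4 := by
    intro s _ hs1
    rcases lt_or_ge s (1 / 4) with h | h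
    · exact Or.inr h
    refine Or.inl ?_
    have := norm_poch_div_le (x := a + s) (y := a + 1) (M := 1) (fun j => ?_) zero_le_one n
    · simpa using this
    · rw [one_mul]
      refine norm_le_norm_of_sq_le ?_
      have : (0 : ℝ) ≤ j := j.cast_nonneg
      simp
      nlinarith
  have k1 := (key (1 / 2) (by norm_num) (by norm_num)).resolve_right (by norm_num)
  have k2 := (key (1 / 4) (by norm_num) (by norm_num)).resolve_right (by norm_num)
  have k3 := (key (3 / 4) (by norm_num) (by norm_num)).resolve_right (by norm_num)
  push_cast at k1 k2 k3
  have e : term a n = (-1) ^ n * ((1 / 4) ^ n * ((poch (a + 1 / 2) n / poch (a + 1) n) *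
      (poch (a + 1 / 4) n / poch (a + 1) n) * (poch (a + 3 / 4) n / poch (a + 1) n)) *
      (20 * (n + a) + 3)) := by
    rw [term, pow_mul, one_div_pow]
    norm_num
    simp only [div_eq_mul_inv]
    ring
  rw [e, norm_mul, norm_pow, norm_neg, norm_one, one_pow, one_mul, norm_mul, norm_mul, norm_pow,
    norm_mul, norm_mul]
  have h4 : ‖(1 / 4 : ℂ)‖ = 1 / 4 := by norm_num
  have h5 : ‖20 * ((n : ℂ) + a) + 3‖ ≤ (20 * n + 23) * (1 + ‖a‖) := by
    have : ‖20 * ((n : ℂ) + a) + 3‖ ≤ 20 * (n + ‖a‖) + 3 := by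
      refine (norm_add_le _ _).trans ?_
      rw [norm_mul]
      have := norm_add_le (n : ℂ) a
      simp at this ⊢
      linarith
    have h6 : 0 ≤ (n : ℝ) * ‖a‖ := by positivity
    nlinarith [norm_nonneg a]
  rw [h4]
  calc _ ≤ (1 / 4 : ℝ) ^ n * (1 * 1 * 1) * ((20 * n + 23) * (1 + ‖a‖)) := by gcongr
    _ = _ := by ring

lemma summable_term_bound : Summable fun n : ℕ => (1 / 4 : ℝ) ^ n * (20 * n + 23) := by
  have h1 := (summable_pow_mul_geometric_of_norm_lt_one 1 (r := (1 / 4 : ℝ)) (by norm_num)).mul_left 20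
  have h2 := (summable_geometric_of_lt_one (r := (1 / 4 : ℝ)) (by norm_num) (by norm_num)).mul_left 23
  refine (h1.add h2).congr fun n => ?_
  ring

lemma exists_norm_f_le : ∃ C : ℝ, 0 ≤ C ∧ ∀ a : ℂ, -1 / 4 ≤ a.re → ‖f a‖ ≤ C * (1 + ‖a‖) := by
  refine ⟨∑' n : ℕ, (1 / 4 : ℝ) ^ n * (20 * n + 23), tsum_nonneg fun n => by positivity,
    fun a ha => ?_⟩
  rw [← tsum_mul_right]
  exact tsum_of_norm_bounded (summable_term_bound.mul_right _).hasSum (norm_term_le ha)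

/-! ### The second series and its Wilf–Zeilberger pair. -/

lemma add_natCast_ne_zero {a : ℂ} (ha : ∀ m : ℕ, a ≠ -((m : ℂ) + 1)) (m : ℕ) : a + 1 + m ≠ 0 :=
  fun h => ha m (by linear_combination h)

lemma ne_of_cos_ne_zero {a : ℂ} (h : Complex.cos (Real.pi * a) ≠ 0) (m : ℤ) :
    a ≠ m + 1 / 2 := by
  rintro rfl
  refine h (Complex.cos_eq_zero_iff.2 ⟨m, ?_⟩)
  ring

lemma term₂_succ (a : ℂ) (n : ℕ) : term₂ a (n + 1) =
    1 / 4 * (((a + 1 / 2) + n) / ((a + 1) + n) * (((2 * a + 1 / 2) + n) / ((3 / 2 - a) + n)))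
      * term₂ a n := by
  simp only [term₂, poch_succ, pow_succ]
  generalize a + 1 + (n : ℂ) = y
  generalize 3 / 2 - a + (n : ℂ) = z
  simp only [div_eq_mul_inv, mul_inv]
  ring

lemma summable_pow_mul_term₂ (a : ℂ) (j : ℕ) : Summable fun n : ℕ => (n : ℂ) ^ j * term₂ a n := by
  refine summable_pow_mul_of_ratio (term₂_succ a) (ρ₀ := 1 / 4 * (1 * 1)) ?_ (by norm_num) j
  exact ((tendsto_add_div_add _ _).mul (tendsto_add_div_add _ _)).const_mul _

lemma summable_term₂ (a : ℂ) : Summable (term₂ a) := by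
  simpa using summable_pow_mul_term₂ a 0

/-- The right-hand companion series of the second reduction. -/
def g₂ (a : ℂ) : ℂ := 48 * a ^ 2 / (2 * a - 1) * ∑' n : ℕ, term₂ a n

/-- The Wilf–Zeilberger mate of `term₂`. -/
def mate₂ (a : ℂ) (k : ℕ) : ℂ :=
  (1 / 2 - a + k) * -(8 * k ^ 2 + (40 * a + 16) * k + 2 * (2 * a + 1) * (20 * a + 3))
    / ((2 * a - 1) * (2 * a + 1)) * term₂ a k

/-- Passing to a + 1 moves every parameter by an integer (2a + 1/2 by two, 3/2 - a by minus one), so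
the quotient of terms is rational in k. The factors on the left may vanish and are therefore not
divided out; `ratio` supplies them later. -/
lemma term₂_add_one {a : ℂ} (ha : ∀ m : ℕ, a + 1 + m ≠ 0) (ha' : ∀ m : ℕ, 1 / 2 - a + m ≠ 0)
    (k : ℕ) :
    (a + 1 / 2) * ((2 * a + 1 / 2) * (2 * a + 3 / 2)) * term₂ (a + 1) k = term₂ a k *
      ((a + 1 / 2 + k) * ((2 * a + 1 / 2 + k) * (2 * a + 3 / 2 + k)) * (a + 1) * (1 / 2 - a + k)
        / ((a + 1 + k) * (1 / 2 - a))) := by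
  have e1 := mul_poch_add_one (a + 1 / 2) k
  have e2 := mul_poch_add_one (2 * a + 1 / 2) k
  have e3 := mul_poch_add_one (2 * a + 1 / 2 + 1) k
  have e4 := mul_poch_add_one (a + 1) k
  have e5 := mul_poch_add_one (1 / 2 - a) k
  rw [show a + 1 / 2 + 1 = a + 1 + 1 / 2 by ring] at e1
  rw [show 2 * a + 1 / 2 + 1 + 1 = 2 * (a + 1) + 1 / 2 by ring,
    show 2 * a + 1 / 2 + 1 = 2 * a + 3 / 2 by ring] at e3
  rw [show 2 * a + 1 / 2 + 1 = 2 * a + 3 / 2 by ring] at e2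
  rw [show 1 / 2 - a + 1 = 3 / 2 - a by ring] at e5
  have n1 : poch (a + 1) k ≠ 0 := poch_ne_zero ha k
  have n2 : poch (1 / 2 - a) k ≠ 0 := poch_ne_zero ha' k
  have n3 : a + 1 ≠ 0 := by simpa using ha 0
  have n4 : 1 / 2 - a ≠ 0 := by simpa using ha' 0
  have n5 := ha k
  have n6 := ha' k
  have f4 : poch (a + 1 + 1) k = poch (a + 1) k * (a + 1 + k) / (a + 1) := by
    rw [eq_div_iff n3, ← e4]; ring
  have f5 : poch (3 / 2 - a) k = poch (1 / 2 - a) k * (1 / 2 - a + k) / (1 / 2 - a) := by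
    rw [eq_div_iff n4, ← e5]; ring
  have f1 : (a + 1 / 2) * ((2 * a + 1 / 2) * (2 * a + 3 / 2)) *
      (poch (a + 1 + 1 / 2) k * poch (2 * (a + 1) + 1 / 2) k) =
      poch (a + 1 / 2) k * (a + 1 / 2 + k) *
        (poch (2 * a + 1 / 2) k * (2 * a + 1 / 2 + k) * (2 * a + 3 / 2 + k)) := by
    linear_combination (2 * a + 1 / 2) * (2 * a + 3 / 2) * poch (2 * (a + 1) + 1 / 2) k * e1 +
      poch (a + 1 / 2) k * (a + 1 / 2 + k) * ((2 * a + 1 / 2) * e3 + (2 * a + 3 / 2 + k) * e2)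
  have f2 : term₂ (a + 1) k = 1 / 4 ^ k * (poch (a + 1 + 1 / 2) k * poch (2 * (a + 1) + 1 / 2) k) /
      (poch (a + 1 + 1) k * poch (1 / 2 - a) k) := by
    rw [term₂, show 3 / 2 - (a + 1) = 1 / 2 - a by ring]; ring
  rw [f2, mul_div_assoc', mul_left_comm, f1, f4, term₂, f5]
  generalize poch (a + 1) k = A at *
  generalize poch (1 / 2 - a) k = B at *
  generalize hy : a + 1 + (k : ℂ) = y at *
  generalize hz : 1 / 2 - a + (k : ℂ) = z at *
  generalize 1 / 2 - a = w at *
  generalize a + 1 = v at *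
  field_simp

/-- Every term is a rational multiple of `term₂ a k`, so this is an identity of rational functions
in a and k. -/
lemma mate₂_sub_succ {a : ℂ} (ha : ∀ m : ℕ, a + 1 + m ≠ 0) (ha' : ∀ m : ℕ, 1 / 2 - a + m ≠ 0)
    (h2 : 2 * a + 1 ≠ 0) (k : ℕ) :
    mate₂ a k - mate₂ a (k + 1) = 48 * a ^ 2 / (2 * a - 1) * term₂ a k
      - ratio a * (48 * (a + 1) ^ 2 / (2 * (a + 1) - 1)) * term₂ (a + 1) k := by
  have n3 : a + 1 ≠ 0 := by simpa using ha 0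
  have n4 : 1 / 2 - a ≠ 0 := by simpa using ha' 0
  have n5 := ha k
  have n6 := ha' (k + 1)
  have n7 : 2 * a - 1 ≠ 0 := fun h => n4 (by linear_combination -h / 2)
  have e := term₂_add_one ha ha' k
  have e' : ratio a * (48 * (a + 1) ^ 2 / (2 * (a + 1) - 1)) * term₂ (a + 1) k =
      -3 / ((a + 1) * (2 * a + 1)) *
      ((a + 1 / 2) * ((2 * a + 1 / 2) * (2 * a + 3 / 2)) * term₂ (a + 1) k) := by
    rw [ratio, show 2 * (a + 1) - 1 = 2 * a + 1 by ring]
    field_simp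
    ring
  rw [e', e, mate₂, mate₂, term₂_succ]
  push_cast at n6 ⊢
  have n8 : 3 / 2 - a + (k : ℂ) ≠ 0 := fun h => n6 (by linear_combination h)
  have n9 : 3 - 2 * a + 2 * (k : ℂ) ≠ 0 := fun h => n8 (by linear_combination h / 2)
  rw [show 1 / 2 - a = -(2 * a - 1) / 2 by ring, show -(2 * a - 1) / 2 + ((k : ℂ) + 1) =
    3 / 2 - a + k by ring]
  field_simp
  ring

lemma g₂_eq_add_ratio_mul {a : ℂ} (ha : ∀ m : ℕ, a + 1 + m ≠ 0)
    (ha' : ∀ m : ℕ, 1 / 2 - a + m ≠ 0) (h2 : 2 * a + 1 ≠ 0) :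
    g₂ a = 20 * a + 3 + ratio a * g₂ (a + 1) := by
  have n4 : 1 / 2 - a ≠ 0 := by simpa using ha' 0
  have n7 : 2 * a - 1 ≠ 0 := fun h => n4 (by linear_combination -h / 2)
  have s1 := (summable_term₂ a).mul_left (48 * a ^ 2 / (2 * a - 1))
  have s2 := (summable_term₂ (a + 1)).mul_left
    (ratio a * (48 * (a + 1) ^ 2 / (2 * (a + 1) - 1)))
  have s3 := s1.sub s2
  -- The mate is a cubic polynomial in k times a geometrically decaying term.
  have hlim : Tendsto (mate₂ a) atTop (𝓝 0) := by
    have t := fun j => (summable_pow_mul_term₂ a j).tendsto_atTop_zero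
    have := ((((t 3).const_mul (-8)).add ((t 2).const_mul (-(8 * (1 / 2 - a) + (40 * a + 16))))).add
      (((t 1).const_mul (-((1 / 2 - a) * (40 * a + 16) + 2 * (2 * a + 1) * (20 * a + 3)))).add
      ((t 0).const_mul (-((1 / 2 - a) * (2 * (2 * a + 1) * (20 * a + 3))))))).const_mul
      (1 / ((2 * a - 1) * (2 * a + 1)))
    refine (this.congr fun k => ?_).trans (by simp)
    rw [mate₂]
    ring
  simp_rw [← mate₂_sub_succ ha ha' h2] at s3
  have h := tsum_sub_succ s3 hlim
  simp_rw [mate₂_sub_succ ha ha' h2] at h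
  rw [s1.tsum_sub s2, tsum_mul_left, tsum_mul_left] at h
  have h0 : mate₂ a 0 = 20 * a + 3 := by
    simp only [mate₂, term₂, poch_zero]
    field_simp
    push_cast
    ring
  rw [h0] at h
  rw [g₂, g₂]
  linear_combination h

/-! ### Asymptotics of rising factorials and the first series. -/

lemma poch_eq_prod (x : ℂ) (n : ℕ) : poch x n = ∏ j ∈ Finset.range n, (x + j) := by
  induction n with
  | zero => simp [poch_zero]
  | succ n ih => rw [poch_succ, Finset.prod_range_succ, ih]


/-- Growth of a quotient of rising factorials. -/
lemma tendsto_poch_div {x y : ℂ} (hx : 0 < x.re) (hy : 0 < y.re) :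
    Tendsto (fun n : ℕ => poch x (n + 1) / poch y (n + 1) * (n : ℂ) ^ (y - x)) atTop
      (𝓝 (Complex.Gamma y / Complex.Gamma x)) := by
  have h := (Complex.GammaSeq_tendsto_Gamma y).div (Complex.GammaSeq_tendsto_Gamma x)
    (Complex.Gamma_ne_zero_of_re_pos hx)
  refine h.congr' ?_
  filter_upwards [eventually_gt_atTop 0] with n hn
  have hn' : (n : ℂ) ≠ 0 := by exact_mod_cast hn.ne'
  have h1 : (n : ℂ) ^ x ≠ 0 := by simp [Complex.cpow_eq_zero_iff, hn']
  have h2 : (n : ℂ) ^ y ≠ 0 := by simp [Complex.cpow_eq_zero_iff, hn']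
  have h3 : (n.factorial : ℂ) ≠ 0 := by exact_mod_cast n.factorial_ne_zero
  have p1 := poch_ne_zero (add_natCast_ne_zero_of_re_pos hx) (n + 1)
  have p2 := poch_ne_zero (add_natCast_ne_zero_of_re_pos hy) (n + 1)
  simp only [Pi.div_apply]
  rw [Complex.GammaSeq, Complex.GammaSeq, ← poch_eq_prod, ← poch_eq_prod, Complex.cpow_sub _ _ hn']
  field_simp

lemma exists_norm_poch_div_le {x y : ℂ} (hx : 0 < x.re) (hy : 0 < y.re) :
    ∃ C : ℝ, 0 ≤ C ∧ ∀ᶠ n : ℕ in atTop,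
      ‖poch x (n + 1) / poch y (n + 1)‖ ≤ C * (n : ℝ) ^ (x.re - y.re) := by
  refine ⟨‖Complex.Gamma y / Complex.Gamma x‖ + 1, by positivity, ?_⟩
  filter_upwards [(tendsto_poch_div hx hy).norm.eventually (gt_mem_nhds (lt_add_one _)),
    eventually_gt_atTop 0] with n h hn
  have hn' : (0 : ℝ) < n := by exact_mod_cast hn
  rw [norm_mul, Complex.norm_natCast_cpow_of_pos hn] at h
  have : (n : ℝ) ^ (x.re - y.re) = ((n : ℝ) ^ (y - x).re)⁻¹ := by
    rw [← Real.rpow_neg hn'.le]; simp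
  rw [this, ← div_eq_mul_inv, le_div_iff₀ (by positivity)]
  exact h.le

/-- The exponents of the two Gamma quotients, -1/2 - Re a each, add up. For Re a > 0 this gives
summability, and also n · `term₁ a n` → 0, which removes the boundary term of the telescoping sum.
-/
lemma exists_norm_term₁_le {a : ℂ} (ha : 0 < a.re) : ∃ C : ℝ, 0 ≤ C ∧ ∀ᶠ n : ℕ in atTop,
    ‖term₁ a (n + 1)‖ ≤ C * (n : ℝ) ^ (-1 - 2 * a.re) := by
  obtain ⟨C, hC, h1⟩ := exists_norm_poch_div_le (x := 1 / 2) (y := a + 1) (by norm_num)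
    (by simp; linarith)
  obtain ⟨D, hD, h2⟩ := exists_norm_poch_div_le (x := a + 1 / 2) (y := 2 * a + 1)
    (by norm_num; linarith) (by simp; linarith)
  refine ⟨C * D, by positivity, ?_⟩
  filter_upwards [h1, h2, eventually_gt_atTop 0] with n h1 h2 hn
  have hn' : (0 : ℝ) < n := by exact_mod_cast hn
  rw [term₁, mul_div_mul_comm, norm_mul]
  calc _ ≤ (C * (n : ℝ) ^ ((1 / 2 : ℂ).re - (a + 1).re)) *
        (D * (n : ℝ) ^ ((a + 1 / 2).re - (2 * a + 1).re)) := by gcongr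
    _ = C * D * (n : ℝ) ^ (-1 - 2 * a.re) := by
      rw [mul_mul_mul_comm, ← Real.rpow_add hn']
      congr 2
      norm_num
      ring

lemma summable_term₁ {a : ℂ} (ha : 0 < a.re) : Summable (term₁ a) := by
  obtain ⟨C, hC, h⟩ := exists_norm_term₁_le ha
  rw [← summable_nat_add_iff 1]
  refine Summable.of_norm_bounded_eventually_nat (g := fun n : ℕ => C * (n : ℝ) ^ (-1 - 2 * a.re))
    ?_ h
  exact (Real.summable_nat_rpow.2 (by linarith)).mul_left _

lemma tendsto_mul_term₁ {a : ℂ} (ha : 0 < a.re) :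
    Tendsto (fun n : ℕ => (n : ℂ) * term₁ a n) atTop (𝓝 0) := by
  obtain ⟨C, hC, h⟩ := exists_norm_term₁_le ha
  rw [← tendsto_add_atTop_iff_nat 1]
  have hl : Tendsto (fun n : ℕ => 2 * C * (n : ℝ) ^ (-(2 * a.re))) atTop (𝓝 0) := by
    simpa using ((tendsto_rpow_neg_atTop (by linarith : 0 < 2 * a.re)).comp
      tendsto_natCast_atTop_atTop).const_mul (2 * C)
  refine squeeze_zero_norm' ?_ hl
  filter_upwards [h, eventually_gt_atTop 0] with n h hn
  have hn' : (1 : ℝ) ≤ n := by exact_mod_cast hn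
  rw [norm_mul]
  have : ‖((n + 1 : ℕ) : ℂ)‖ = n + 1 := by rw [Complex.norm_natCast]; push_cast; rfl
  rw [this]
  calc _ ≤ (2 * n : ℝ) * (C * (n : ℝ) ^ (-1 - 2 * a.re)) := by gcongr; linarith
    _ = 2 * C * ((n : ℝ) ^ (1 : ℝ) * (n : ℝ) ^ (-1 - 2 * a.re)) := by rw [Real.rpow_one]; ring
    _ = _ := by rw [← Real.rpow_add (by linarith)]; congr 2; ring

lemma tendsto_const_div_add (x : ℂ) : Tendsto (fun n : ℕ => x / (x + n)) atTop (𝓝 0) := by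
  simpa using tendsto_add_mul_div_add_mul_atTop_nhds x x (0 : ℂ) (one_ne_zero)

/-- The right-hand side of the first reduction. -/
def g₁ (a : ℂ) : ℂ := 16 * a * ∑' n : ℕ, term₁ a n

/-- The Wilf–Zeilberger mate of `term₁`. -/
def mate₁ (a : ℂ) (k : ℕ) : ℂ :=
  ((20 * a + 3) * (2 * a + 1) + (32 * a + 10) * k + 8 * k ^ 2) / (2 * a + 1 + k) * term₁ a k

lemma term₁_add_one {a : ℂ} (ha : 0 < a.re) (k : ℕ) :
    (a + 1 / 2) * term₁ (a + 1) k = term₁ a k *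
      ((a + 1 / 2 + k) * (a + 1) * ((2 * a + 1) * (2 * a + 2))
        / ((a + 1 + k) * ((2 * a + 1 + k) * (2 * a + 2 + k)))) := by
  have p1 : 0 < (a + 1).re := by simp; linarith
  have p2 : 0 < (2 * a + 1).re := by simp; linarith
  have p3 : 0 < (2 * a + 2).re := by simp; linarith
  have e1 := mul_poch_add_one (a + 1 / 2) k
  have e2 := mul_poch_add_one (2 * a + 1) k
  have e3 := mul_poch_add_one (2 * a + 1 + 1) k
  have e4 := mul_poch_add_one (a + 1) k
  rw [show a + 1 / 2 + 1 = a + 1 + 1 / 2 by ring] at e1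
  rw [show 2 * a + 1 + 1 + 1 = 2 * (a + 1) + 1 by ring,
    show 2 * a + 1 + 1 = 2 * a + 2 by ring] at e3
  rw [show 2 * a + 1 + 1 = 2 * a + 2 by ring] at e2
  have n1 : poch (a + 1) k ≠ 0 := poch_ne_zero (add_natCast_ne_zero_of_re_pos p1) k
  have n2 : poch (2 * a + 1) k ≠ 0 := poch_ne_zero (add_natCast_ne_zero_of_re_pos p2) k
  have n3 : a + 1 ≠ 0 := by simpa using add_natCast_ne_zero_of_re_pos p1 0
  have n4 : 2 * a + 1 ≠ 0 := by simpa using add_natCast_ne_zero_of_re_pos p2 0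
  have n5 : 2 * a + 2 ≠ 0 := by simpa using add_natCast_ne_zero_of_re_pos p3 0
  have n6 := add_natCast_ne_zero_of_re_pos p1 k
  have n7 := add_natCast_ne_zero_of_re_pos p2 k
  have n8 := add_natCast_ne_zero_of_re_pos p3 k
  have f4 : poch (a + 1 + 1) k = poch (a + 1) k * (a + 1 + k) / (a + 1) := by
    rw [eq_div_iff n3, ← e4]; ring
  have f2 : poch (2 * a + 2) k = poch (2 * a + 1) k * (2 * a + 1 + k) / (2 * a + 1) := by
    rw [eq_div_iff n4, ← e2]; ring
  have f3 : poch (2 * (a + 1) + 1) k = poch (2 * a + 2) k * (2 * a + 2 + k) / (2 * a + 2) := by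
    rw [eq_div_iff n5, ← e3]; ring
  rw [term₁, mul_div_assoc', mul_left_comm, e1, f3, f2, f4, term₁]
  generalize a + 1 + (k : ℂ) = y at *
  generalize 2 * a + 1 + (k : ℂ) = z at *
  generalize 2 * a + 2 + (k : ℂ) = w at *
  field_simp

lemma term₁_succ (a : ℂ) (n : ℕ) : term₁ a (n + 1) =
    ((1 / 2 + n) / ((a + 1) + n) * (((a + 1 / 2) + n) / ((2 * a + 1) + n))) * term₁ a n := by
  simp only [term₁, poch_succ]
  generalize a + 1 + (n : ℂ) = y
  generalize 2 * a + 1 + (n : ℂ) = z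
  simp only [div_eq_mul_inv, mul_inv]
  ring

lemma mate₁_sub_succ {a : ℂ} (ha : 0 < a.re) (k : ℕ) :
    mate₁ a k - mate₁ a (k + 1) = 16 * a * term₁ a k
      - ratio a * (16 * (a + 1)) * term₁ (a + 1) k := by
  have p1 : 0 < (a + 1).re := by simp; linarith
  have p2 : 0 < (2 * a + 1).re := by simp; linarith
  have p3 : 0 < (2 * a + 2).re := by simp; linarith
  have n3 : a + 1 ≠ 0 := by simpa using add_natCast_ne_zero_of_re_pos p1 0
  have n6 := add_natCast_ne_zero_of_re_pos p1 k
  have n7 := add_natCast_ne_zero_of_re_pos p2 k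
  have n8 := add_natCast_ne_zero_of_re_pos p3 k
  have e := term₁_add_one ha k
  have e' : ratio a * (16 * (a + 1)) * term₁ (a + 1) k =
      -4 * (a + 1 / 4) * (a + 3 / 4) / (a + 1) ^ 2 * ((a + 1 / 2) * term₁ (a + 1) k) := by
    rw [ratio]
    field_simp
    ring
  rw [e', e, mate₁, mate₁, term₁_succ]
  push_cast
  have n10 : 2 * (a + 1) + (k : ℂ) ≠ 0 := fun h => n8 (by linear_combination h)
  have n11 : a * 2 + 1 + (k : ℂ) ≠ 0 := fun h => n7 (by linear_combination h)
  rw [show 2 * a + 1 + ((k : ℂ) + 1) = 2 * a + 2 + k by ring]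
  field_simp
  ring

lemma g₁_eq_add_ratio_mul {a : ℂ} (ha : 0 < a.re) :
    g₁ a = 20 * a + 3 + ratio a * g₁ (a + 1) := by
  have s1 := (summable_term₁ ha).mul_left (16 * a)
  have s2 := (summable_term₁ (a := a + 1) (by simp; linarith)).mul_left
    (ratio a * (16 * (a + 1)))
  have s3 := s1.sub s2
  have p2 : 0 < (2 * a + 1).re := by simp; linarith
  have hlim : Tendsto (mate₁ a) atTop (𝓝 0) := by
    have t0 := (summable_term₁ ha).tendsto_atTop_zero
    have t1 := tendsto_mul_term₁ ha
    -- The rational factor of the mate grows only linearly in k; it is split into a constant over 2a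
    -- + 1 + k and k times a bounded quotient.
    have := (((t0.const_mul (20 * a + 3)).mul (tendsto_const_div_add (2 * a + 1))).add
      ((t1.const_mul 8).mul (tendsto_add_div_add ((32 * a + 10) / 8) (2 * a + 1))))
    refine (this.congr fun k => ?_).trans (by simp)
    have n7 := add_natCast_ne_zero_of_re_pos p2 k
    rw [mate₁]
    field_simp
    ring
  simp_rw [← mate₁_sub_succ ha] at s3
  have h := tsum_sub_succ s3 hlim
  simp_rw [mate₁_sub_succ ha] at h
  rw [s1.tsum_sub s2, tsum_mul_left, tsum_mul_left] at h
  have h0 : mate₁ a 0 = 20 * a + 3 := by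
    have n4 : 2 * a + 1 ≠ 0 := by simpa using add_natCast_ne_zero_of_re_pos p2 0
    simp only [mate₁, term₁, poch_zero]
    push_cast
    simp
    rw [mul_div_assoc, div_self n4, mul_one]
  rw [h0] at h
  rw [g₁, g₁]
  linear_combination h

/-! ### Uniqueness by growth and the first reduction. -/

/-- A solution of `D a = ratio a * D (a + 1)` of linear growth to the right vanishes. -/
lemma eq_zero_of_eq_ratio_mul {D : ℂ → ℂ} {C : ℝ} (hD : ∀ a : ℂ, 0 < a.re → D a = ratio a * D (a + 1))
    (hC : ∀ a : ℂ, 1 ≤ a.re → ‖D a‖ ≤ C * (1 + ‖a‖)) {a : ℂ} (ha : 0 < a.re) : D a = 0 := by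
  have h1 : ∀ N : ℕ, ‖D a‖ ≤ (1 / 4) ^ N * ‖D (a + N)‖ := by
    intro N
    induction N with
    | zero => simp
    | succ N ih =>
      refine ih.trans ?_
      have p : 0 < (a + N).re := by
        have : (0 : ℝ) ≤ N := N.cast_nonneg
        simp; linarith
      rw [hD _ p, norm_mul, pow_succ, mul_assoc]
      gcongr
      · exact norm_ratio_le p.le
      · push_cast; rw [add_assoc]
  have h2 : ∀ᶠ N : ℕ in atTop, ‖D a‖ ≤ (1 / 4) ^ N * (C * (1 + ‖a‖)) + C * (N ^ 1 * (1 / 4) ^ N) := by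
    filter_upwards [eventually_ge_atTop 1] with N hN
    have hN' : (1 : ℝ) ≤ N := by exact_mod_cast hN
    have hb := hC (a + N) (by simp; linarith)
    have h0 : 0 ≤ C := by
      have : 0 ≤ C * (1 + ‖a + N‖) := (norm_nonneg _).trans hb
      exact nonneg_of_mul_nonneg_left this (by positivity)
    have hn : ‖a + N‖ ≤ ‖a‖ + N := by simpa using norm_add_le a (N : ℂ)
    calc ‖D a‖ ≤ (1 / 4) ^ N * (C * (1 + (‖a‖ + N))) := by
          refine (h1 N).trans ?_
          gcongr
          exact hb.trans (by gcongr)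
      _ = _ := by ring
  have h3 : Tendsto (fun N : ℕ => (1 / 4 : ℝ) ^ N * (C * (1 + ‖a‖)) + C * ((N : ℝ) ^ 1 * (1 / 4) ^ N))
      atTop (𝓝 0) := by
    have t1 := (tendsto_pow_atTop_nhds_zero_of_lt_one (r := (1 / 4 : ℝ)) (by norm_num)
      (by norm_num)).mul_const (C * (1 + ‖a‖))
    have t2 := (tendsto_pow_const_mul_const_pow_of_abs_lt_one 1 (r := (1 / 4 : ℝ))
      (by rw [abs_of_pos] <;> norm_num)).const_mul C
    simpa using t1.add t2
  exact norm_le_zero_iff.1 (ge_of_tendsto h3 h2)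

/-- For Re a ≥ 1 the terms are dominated by (1/2)_n / (3)_n, of order n^(-5/2), uniformly in a; the
prefactor 16a gives the linear growth. -/
lemma exists_norm_g₁_le : ∃ C : ℝ, 0 ≤ C ∧ ∀ a : ℂ, 1 ≤ a.re → ‖g₁ a‖ ≤ C * (1 + ‖a‖) := by
  have hs : Summable fun n => ‖poch (1 / 2) n / poch 3 n‖ := by
    obtain ⟨C, hC, h⟩ := exists_norm_poch_div_le (x := 1 / 2) (y := 3) (by norm_num) (by norm_num)
    rw [← summable_nat_add_iff 1]
    refine Summable.of_norm_bounded_eventually_nat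
      ((Real.summable_nat_rpow (p := (1 / 2 : ℂ).re - (3 : ℂ).re)).2 (by norm_num) |>.mul_left C) ?_
    simpa using h
  refine ⟨16 * ∑' n, ‖poch (1 / 2) n / poch 3 n‖,
    mul_nonneg (by norm_num) (tsum_nonneg fun _ => norm_nonneg _), fun a ha => ?_⟩
  have hb : ∀ n, ‖term₁ a n‖ ≤ ‖poch (1 / 2) n / poch 3 n‖ := by
    intro n
    have h1 : ‖poch (a + 1 / 2) n / poch (a + 1) n‖ ≤ 1 ^ n := by
      refine norm_poch_div_le (fun j => ?_) zero_le_one n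
      rw [one_mul]
      refine norm_le_norm_of_sq_le ?_
      have : (0 : ℝ) ≤ j := j.cast_nonneg
      norm_num
      nlinarith
    have h2 : ‖poch 3 n‖ ≤ ‖poch (2 * a + 1) n‖ := by
      have := norm_poch_le (x := 3) (y := 2 * a + 1) (M := 1) (fun j => ?_) zero_le_one n
      · simpa using this
      rw [one_mul]
      refine norm_le_norm_of_sq_le ?_
      have : (0 : ℝ) ≤ j := j.cast_nonneg
      norm_num
      nlinarith [sq_nonneg a.im]
    have h3 : 0 < ‖poch 3 n‖ :=
      norm_pos_iff.2 (poch_ne_zero (add_natCast_ne_zero_of_re_pos (by norm_num)) n)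
    rw [term₁, mul_comm (poch (a + 1) n), mul_div_mul_comm, norm_mul, norm_div, norm_div]
    rw [one_pow, norm_div] at h1
    calc _ ≤ ‖poch (1 / 2) n‖ / ‖poch 3 n‖ * 1 := by gcongr
      _ = _ := by rw [mul_one, norm_div]
  have h4 := tsum_of_norm_bounded hs.hasSum hb
  have h5 : 0 ≤ ∑' n, ‖poch (1 / 2) n / poch 3 n‖ := tsum_nonneg fun _ => norm_nonneg _
  rw [g₁, norm_mul, norm_mul]
  have : ‖(16 : ℂ)‖ = 16 := by norm_num
  rw [this]
  calc _ ≤ 16 * ‖a‖ * ∑' n, ‖poch (1 / 2) n / poch 3 n‖ := by gcongr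
    _ ≤ _ := by nlinarith

theorem f_eq_g₁ {a : ℂ} (ha : 0 < a.re) : f a = g₁ a := by
  obtain ⟨C, hC, h1⟩ := exists_norm_f_le
  obtain ⟨C', hC', h2⟩ := exists_norm_g₁_le
  refine sub_eq_zero.1 (eq_zero_of_eq_ratio_mul (D := fun a => f a - g₁ a) (C := C + C') ?_ ?_ ha)
  · intro a ha
    rw [f_eq_add_ratio_mul a, g₁_eq_add_ratio_mul ha]
    ring
  · intro a ha
    refine (norm_sub_le _ _).trans ?_
    have := h1 a (by linarith)
    have := h2 a ha
    linarith

/-! ### The value at 1/2. -/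

lemma sum_range_alternating_harmonic (N : ℕ) :
    ∑ n ∈ Finset.range N, (1 / (2 * (n : ℝ) + 1) - 1 / (2 * n + 2)) =
      harmonic (2 * N) - harmonic N := by
  induction N with
  | zero => simp
  | succ N ih =>
    rw [Finset.sum_range_succ, ih, mul_add, mul_one, harmonic_succ, harmonic_succ, harmonic_succ]
    push_cast
    have h1 : (2 * (N : ℝ) + 1) ≠ 0 := by positivity
    have h2 : ((N : ℝ) + 1) ≠ 0 := by positivity
    have h3 : (2 * (N : ℝ) + 1 + 1) ≠ 0 := by positivity
    rw [show 2 * (N : ℝ) + 2 = 2 * (N + 1) by ring, show 2 * (N : ℝ) + 1 + 1 = 2 * (N + 1) by ring]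
    field_simp
    ring

/-- In H_{2N} - H_N the Euler constants cancel and log 2N - log N remains. -/
lemma tendsto_alternating_harmonic :
    Tendsto (fun N => ∑ n ∈ Finset.range N, (1 / (2 * (n : ℝ) + 1) - 1 / (2 * n + 2))) atTop
      (𝓝 (Real.log 2)) := by
  have h := Real.tendsto_harmonic_sub_log
  have h' := h.comp (tendsto_id.const_mul_atTop' (r := 2) (by norm_num))
  have := (h'.sub h).add_const (Real.log 2)
  rw [sub_self, zero_add] at this
  refine this.congr' ?_
  filter_upwards [eventually_gt_atTop 0] with N hN
  have hN' : (N : ℝ) ≠ 0 := by positivity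
  rw [sum_range_alternating_harmonic]
  simp only [Function.comp, id]
  push_cast
  rw [Real.log_mul two_ne_zero hN']
  ring

theorem f_one_half : f (1 / 2) = ((16 * Real.log 2 : ℝ) : ℂ) := by
  -- The rising factorials cancel to 1/((2n + 1)(n + 1)), here in partial fractions.
  have ht : ∀ n, term₁ (1 / 2) n = ((2 * (1 / (2 * (n : ℝ) + 1) - 1 / (2 * n + 2)) : ℝ) : ℂ) := by
    intro n
    have e1 := mul_poch_add_one (1 / 2) n
    have e2 := mul_poch_add_one 1 n
    have n1 : poch (1 / 2) n ≠ 0 := poch_ne_zero (add_natCast_ne_zero_of_re_pos (by norm_num)) n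
    have n2 : poch 1 n ≠ 0 := poch_ne_zero (add_natCast_ne_zero_of_re_pos (by norm_num)) n
    have n3 : (1 + (n : ℂ)) ≠ 0 := by exact_mod_cast (by omega : 1 + n ≠ 0)
    have n4 : (2 * (n : ℂ) + 1) ≠ 0 := by exact_mod_cast (by omega : 2 * n + 1 ≠ 0)
    rw [one_mul] at e2
    have e1' : poch (1 / 2 + 1) n = poch (1 / 2) n * (2 * n + 1) := by linear_combination 2 * e1
    rw [term₁, show (1 / 2 + 1 / 2 : ℂ) = 1 by norm_num, show (2 * (1 / 2) + 1 : ℂ) = 1 + 1 by norm_num,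
      e1', e2]
    push_cast
    rw [show 2 * (n : ℂ) + 2 = 2 * (1 + n) by ring]
    field_simp
    ring
  have hs : Summable (term₁ (1 / 2)) := summable_term₁ (by norm_num)
  have h : ∑' n, term₁ (1 / 2) n = ((2 * Real.log 2 : ℝ) : ℂ) := by
    refine tendsto_nhds_unique hs.hasSum.tendsto_sum_nat ?_
    simp_rw [ht, ← Complex.ofReal_sum, ← Finset.mul_sum]
    exact (Complex.continuous_ofReal.tendsto _).comp (tendsto_alternating_harmonic.const_mul 2)
  rw [f_eq_g₁ (by norm_num), g₁, h]
  push_cast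
  ring

/-! ### The arcsine series and the second series at 0. -/

/-- The coefficients `(1/2)_n / n!` of `(1 - x)^(-1/2)`. -/
def halfCoeff (n : ℕ) : ℝ := (ascPochhammer ℝ n).eval (1 / 2) / n.factorial

lemma halfCoeff_succ (n : ℕ) : halfCoeff (n + 1) = halfCoeff n * ((1 / 2 + n) / (n + 1)) := by
  rw [halfCoeff, halfCoeff, ascPochhammer_succ_eval, Nat.factorial_succ]
  push_cast
  field_simp

lemma halfCoeff_zero : halfCoeff 0 = 1 := by simp [halfCoeff]

lemma halfCoeff_mem (n : ℕ) : 0 < halfCoeff n ∧ halfCoeff n ≤ 1 := by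
  induction n with
  | zero => simp [halfCoeff_zero]
  | succ n ih =>
    rw [halfCoeff_succ]
    refine ⟨mul_pos ih.1 (by positivity), mul_le_one₀ ih.2 (by positivity) ?_⟩
    rw [div_le_one (by positivity)]
    linarith

lemma hasSum_halfCoeff {x : ℝ} (hx : |x| < 1) :
    HasSum (fun n => halfCoeff n * x ^ n) (1 / Real.sqrt (1 - x)) := by
  have h := (Real.one_div_one_sub_rpow_hasFPowerSeriesOnBall_zero (1 / 2)).hasSum (y := x)
    (by rw [Metric.mem_eball, edist_zero_right, ← ofReal_norm, Real.norm_eq_abs]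
        exact ENNReal.ofReal_lt_one.2 hx)
  rw [zero_add, ← Real.sqrt_eq_rpow] at h
  refine (congrArg (fun u : ℕ → ℝ => HasSum u _) (funext fun n => ?_)).mpr h
  rw [FormalMultilinearSeries.ofScalars_apply_eq, smul_eq_mul]
  congr 1
  have h1 := Ring.factorial_nsmul_multichoose_eq_ascPochhammer (1 / 2 : ℝ) n
  rw [Ring.choose, show (1 / 2 + (n : ℝ) - 1 - n + 1) = 1 / 2 by ring, halfCoeff,
    div_eq_iff (by exact_mod_cast n.factorial_ne_zero), mul_comm, ← nsmul_eq_mul, h1,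
    Polynomial.ascPochhammer_smeval_eq_eval]

/-- Termwise differentiation; any interval containing 0 and 1/2 and compactly inside (-1, 1) would
do, and this one gives the majorant (9/16)^n. -/
lemma hasDerivAt_tsum_halfCoeff {x : ℝ} (hx : x ∈ Set.Ioo (-3 / 4 : ℝ) (3 / 4)) :
    HasDerivAt (fun x : ℝ => ∑' n, halfCoeff n * x ^ (2 * n + 1) / (2 * n + 1))
      (1 / Real.sqrt (1 - x ^ 2)) x := by
  have hxs : |x ^ 2| < 1 := by
    rw [abs_of_nonneg (sq_nonneg x)]; nlinarith [hx.1, hx.2]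
  rw [← (hasSum_halfCoeff hxs).tsum_eq]
  refine hasDerivAt_tsum_of_isPreconnected (u := fun n => (9 / 16 : ℝ) ^ n)
    (t := Set.Ioo (-3 / 4) (3 / 4)) (y₀ := 0)
    (summable_geometric_of_lt_one (by norm_num) (by norm_num)) isOpen_Ioo isPreconnected_Ioo
    (g' := fun n x => halfCoeff n * (x ^ 2) ^ n) ?_ ?_ (by norm_num) ?_ hx
  · intro n y _
    have := ((hasDerivAt_pow (2 * n + 1) y).const_mul (halfCoeff n)).div_const (2 * (n : ℝ) + 1)
    refine this.congr_deriv ?_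
    have : (2 * (n : ℝ) + 1) ≠ 0 := by positivity
    push_cast
    rw [← pow_mul]
    field_simp
  · intro n y hy
    rw [norm_mul, norm_pow, Real.norm_of_nonneg (halfCoeff_mem n).1.le,
      Real.norm_of_nonneg (sq_nonneg y)]
    have : y ^ 2 ≤ 9 / 16 := by nlinarith [hy.1, hy.2]
    calc _ ≤ 1 * (9 / 16 : ℝ) ^ n := by gcongr; exact (halfCoeff_mem n).2
      _ = _ := one_mul _
  · simp

/-- The series and arcsin have the same derivative and agree at 0. -/
lemma tsum_halfCoeff_half : ∑' n, halfCoeff n * (1 / 2) ^ (2 * n + 1) / (2 * n + 1) = Real.pi / 6 := by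
  let F : ℝ → ℝ := fun x => (∑' n, halfCoeff n * x ^ (2 * n + 1) / (2 * n + 1)) - Real.arcsin x
  have hF : ∀ x ∈ Set.Ioo (-3 / 4 : ℝ) (3 / 4), HasDerivAt F 0 x := by
    intro x hx
    exact ((hasDerivAt_tsum_halfCoeff hx).sub (Real.hasDerivAt_arcsin (x := x)
      (by linarith [hx.1]) (by linarith [hx.2]))).congr_deriv (sub_self _)
  have h := isOpen_Ioo.is_const_of_deriv_eq_zero isPreconnected_Ioo
    (fun x hx => (hF x hx).differentiableAt.differentiableWithinAt)
    (fun x hx => (hF x hx).deriv) (x := 1 / 2) (y := 0) (by norm_num) (by norm_num)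
  have h0 : F 0 = 0 := by simp [F]
  rw [h0] at h
  have h1 : Real.arcsin (1 / 2) = Real.pi / 6 :=
    Real.arcsin_eq_of_sin_eq (Real.sin_pi_div_six) ⟨by linarith [Real.pi_pos], by linarith [Real.pi_pos]⟩
  have h2 := sub_eq_zero.1 h
  rw [h1] at h2
  exact h2

lemma tsum_term₂_zero : ∑' n, term₂ 0 n = Real.pi / 3 := by
  have ht : ∀ n, term₂ 0 n =
      ((2 * (halfCoeff n * (1 / 2) ^ (2 * n + 1) / (2 * n + 1)) : ℝ) : ℂ) := by
    intro n
    have e1 := mul_poch_add_one (1 / 2) n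
    have n1 : poch (1 / 2) n ≠ 0 := poch_ne_zero (add_natCast_ne_zero_of_re_pos (by norm_num)) n
    have n4 : (2 * (n : ℂ) + 1) ≠ 0 := by exact_mod_cast (by omega : 2 * n + 1 ≠ 0)
    have n5 : (n.factorial : ℂ) ≠ 0 := by exact_mod_cast n.factorial_ne_zero
    have e1' : poch (1 / 2 + 1) n = poch (1 / 2) n * (2 * n + 1) := by linear_combination 2 * e1
    have e2 : poch 1 n = n.factorial := by rw [poch, ascPochhammer_eval_one]
    have e3 : ((halfCoeff n : ℝ) : ℂ) = poch (1 / 2) n / n.factorial := by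
      rw [halfCoeff, poch]
      push_cast
      congr 1
      have := Polynomial.eval_map_apply (f := algebraMap ℝ ℂ) (p := ascPochhammer ℝ n) (1 / 2 : ℝ)
      rw [ascPochhammer_map] at this
      simpa using this.symm
    rw [term₂, show (3 / 2 - 0 : ℂ) = 1 / 2 + 1 by norm_num, show (0 + 1 / 2 : ℂ) = 1 / 2 by norm_num,
      show (2 * 0 + 1 / 2 : ℂ) = 1 / 2 by norm_num, zero_add, e1', e2]
    push_cast
    rw [e3, pow_succ, pow_mul, show ((1 / 2) ^ 2 : ℂ) = 1 / 4 by norm_num, one_div_pow]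
    field_simp
  simp_rw [ht]
  rw [← Complex.ofReal_tsum, tsum_mul_left, tsum_halfCoeff_half]
  push_cast
  ring

/-! ### Antiperiodic functions on a strip. -/

/-- The strip on which the periodicity argument takes place. -/
def strip : Set ℂ := {a | -1 / 5 < a.re ∧ a.re < 9 / 10}

lemma isOpen_strip : IsOpen strip :=
  (isOpen_lt continuous_const Complex.continuous_re).inter
    (isOpen_lt Complex.continuous_re continuous_const)

/-- The antiperiodic extension to `ℂ` of a function on the strip. -/
def extend (q : ℂ → ℂ) (a : ℂ) : ℂ :=
  (-1) ^ ⌊a.re + 1 / 8⌋ * q (a - ⌊a.re + 1 / 8⌋)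

lemma extend_add_one (q : ℂ → ℂ) (a : ℂ) : extend q (a + 1) = -extend q a := by
  have : ⌊(a + 1).re + 1 / 8⌋ = ⌊a.re + 1 / 8⌋ + 1 := by
    rw [← Int.floor_add_one]; congr 1; simp; ring
  rw [extend, this, extend, zpow_add_one₀ (by norm_num)]
  push_cast
  rw [add_sub_add_right_eq_sub]
  ring

/-- The strip is wider than the fundamental domain -1/8 ≤ Re a < 7/8, so m can differ from the floor
by one; antiperiodicity on the overlap reconciles the choices. This gluing makes the extension
holomorphic across the seams. -/
lemma extend_eq {q : ℂ → ℂ} (hp : ∀ a : ℂ, -1 / 5 < a.re → a.re < -1 / 10 → q (a + 1) = -q a)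
    {a : ℂ} {m : ℤ} (h : a - m ∈ strip) : extend q a = (-1) ^ m * q (a - m) := by
  obtain ⟨h1, h2⟩ := h
  simp only [Complex.sub_re, Complex.intCast_re] at h1 h2
  rcases lt_or_ge (a.re - m) (-1 / 8) with h3 | h3
  · have hf : ⌊a.re + 1 / 8⌋ = m - 1 := by
      rw [Int.floor_eq_iff]; push_cast; constructor <;> linarith
    have := hp (a - m) (by simpa using h1) (by simp; linarith)
    rw [extend, hf, zpow_sub_one₀ (by norm_num)]
    push_cast
    rw [show a - (m - 1) = a - m + 1 by ring, this]
    ring_nf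
  rcases lt_or_ge (a.re - m) (7 / 8) with h4 | h4
  · have hf : ⌊a.re + 1 / 8⌋ = m := by
      rw [Int.floor_eq_iff]; constructor <;> linarith
    rw [extend, hf]
  · have hf : ⌊a.re + 1 / 8⌋ = m + 1 := by
      rw [Int.floor_eq_iff]; push_cast; constructor <;> linarith
    have := hp (a - (m + 1)) (by simp; linarith) (by simp; linarith)
    rw [extend, hf, zpow_add_one₀ (by norm_num)]
    push_cast
    rw [show a - (m : ℂ) = a - (m + 1) + 1 by ring, this]
    ring

lemma differentiable_extend {q : ℂ → ℂ} (hd : DifferentiableOn ℂ q strip)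
    (hp : ∀ a : ℂ, -1 / 5 < a.re → a.re < -1 / 10 → q (a + 1) = -q a) :
    Differentiable ℂ (extend q) := by
  intro a₀
  set m := ⌊a₀.re + 1 / 8⌋ with hm
  have h0 : a₀ - m ∈ strip := by
    have h1 := Int.floor_le (a₀.re + 1 / 8)
    have h2 := Int.lt_floor_add_one (a₀.re + 1 / 8)
    rw [← hm] at h1 h2
    constructor <;> simp <;> linarith
  have hc : ContinuousAt (fun a : ℂ => a - m) a₀ := by fun_prop
  have hev : extend q =ᶠ[𝓝 a₀] fun a => (-1) ^ m * q (a - m) := by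
    filter_upwards [hc (isOpen_strip.mem_nhds h0)] with a ha using extend_eq hp ha
  refine DifferentiableAt.congr_of_eventuallyEq ?_ hev
  refine DifferentiableAt.const_mul ?_ _
  exact (hd.differentiableAt (isOpen_strip.mem_nhds h0)).comp (f := fun a : ℂ => a - m) a₀
    (by fun_prop)

lemma norm_extend_le {q : ℂ → ℂ} {C : ℝ} (hb : ∀ a : ℂ, -1 / 8 ≤ a.re → a.re ≤ 7 / 8 →
    ‖q a‖ ≤ C * (1 + |a.im|)) (a : ℂ) : ‖extend q a‖ ≤ C * (1 + |a.im|) := by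
  have h1 := Int.floor_le (a.re + 1 / 8)
  have h2 := Int.lt_floor_add_one (a.re + 1 / 8)
  rw [extend, norm_mul, norm_zpow, norm_neg, norm_one, one_zpow, one_mul]
  refine (hb _ ?_ ?_).trans_eq ?_
  · simp; linarith
  · simp; linarith
  · simp

/-- An entire function of linear growth is affine. -/
lemma exists_eq_add_mul_of_norm_le {Q : ℂ → ℂ} (hd : Differentiable ℂ Q) {C : ℝ}
    (hb : ∀ a, ‖Q a‖ ≤ C * (1 + ‖a‖)) : ∃ c, ∀ a, Q a = Q 0 + a * c := by
  -- The slope of Q at 0 is entire and bounded, so Liouville's theorem makes it constant.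
  have hR : Differentiable ℂ (dslope Q 0) := by
    rw [← differentiableOn_univ] at hd ⊢
    exact (Complex.differentiableOn_dslope univ_mem).2 hd
  have hC : 0 ≤ C := by simpa using (norm_nonneg _).trans (hb 0)
  have hbd : Bornology.IsBounded (Set.range (dslope Q 0)) := by
    obtain ⟨M, hM⟩ := (isCompact_closedBall (0 : ℂ) 1).exists_bound_of_continuousOn
      hR.continuous.continuousOn
    rw [isBounded_iff_forall_norm_le]
    refine ⟨max M (2 * C + ‖Q 0‖), ?_⟩
    rintro _ ⟨a, rfl⟩
    rcases le_total ‖a‖ 1 with h | h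
    · exact le_max_of_le_left (hM a (by simpa using h))
    · refine le_max_of_le_right ?_
      have ha : a ≠ 0 := norm_pos_iff.1 (by linarith)
      rw [dslope_of_ne _ ha, slope_def_field, sub_zero, norm_div,
        div_le_iff₀ (norm_pos_iff.2 ha)]
      refine (norm_sub_le _ _).trans ?_
      nlinarith [hb a, norm_nonneg (Q 0)]
  refine ⟨dslope Q 0 0, fun a => ?_⟩
  rw [hR.apply_eq_apply_of_bounded hbd 0 a]
  have := sub_smul_dslope Q 0 a
  rw [sub_zero, smul_eq_mul] at this
  rw [this]
  ring

/-- The extension is affine by its growth. Its values at 0, 1 and 2 alternate in sign, which kills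
first the slope and then the constant. -/
theorem eq_zero_of_antiperiodic_on_strip {q : ℂ → ℂ} (hd : DifferentiableOn ℂ q strip)
    (hp : ∀ a : ℂ, -1 / 5 < a.re → a.re < -1 / 10 → q (a + 1) = -q a) {C : ℝ}
    (hb : ∀ a : ℂ, -1 / 8 ≤ a.re → a.re ≤ 7 / 8 → ‖q a‖ ≤ C * (1 + |a.im|)) {a : ℂ}
    (ha : a ∈ strip) : q a = 0 := by
  have hC : 0 ≤ C := by
    simpa using (norm_nonneg _).trans (hb 0 (by norm_num) (by norm_num))
  obtain ⟨c, hc⟩ := exists_eq_add_mul_of_norm_le (differentiable_extend hd hp) (C := C)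
    fun a => (norm_extend_le hb a).trans (by gcongr; exact Complex.abs_im_le_norm a)
  have h1 := extend_add_one q 0
  have h2 := extend_add_one q 1
  have e1 := hc 1
  have e2 := hc (1 + 1)
  rw [zero_add] at h1
  have hc0 : c = 0 := by linear_combination (-e2 + h2 - h1) / 2
  have hQ : extend q 0 = 0 := by linear_combination (h1 - e1 - hc0) / 2
  have := extend_eq hp (a := a) (m := 0) (by simpa using ha)
  rw [hc a, hQ, hc0] at this
  simpa using this.symm

/-! ### Holomorphy and bounds on the strip. -/

lemma differentiable_poch (n : ℕ) : Differentiable ℂ fun x => poch x n :=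
  (ascPochhammer ℂ n).differentiable

lemma isOpen_re_gt (x : ℝ) : IsOpen {a : ℂ | x < a.re} :=
  isOpen_lt continuous_const Complex.continuous_re

lemma differentiableAt_f {a : ℂ} (ha : -1 / 4 < a.re) : DifferentiableAt ℂ f a := by
  -- The ball makes the factor 1 + ‖a‖ of the majorant uniform.
  set U : Set ℂ := {a | -1 / 4 < a.re} ∩ Metric.ball 0 (‖a‖ + 1)
  have hU : IsOpen U := (isOpen_re_gt _).inter Metric.isOpen_ball
  have haU : a ∈ U := ⟨ha, by simp⟩
  refine DifferentiableOn.differentiableAt (s := U) ?_ (hU.mem_nhds haU)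
  refine Complex.differentiableOn_tsum_of_summable_norm
    (u := fun n : ℕ => (1 / 4) ^ n * (20 * n + 23) * (1 + (‖a‖ + 1)))
    (summable_term_bound.mul_right _) (fun n b hb => ?_) hU fun n b hb => ?_
  · have h1 : poch (b + 1) n ≠ 0 := poch_ne_zero (add_natCast_ne_zero_of_re_pos (by
      have := hb.1
      simp at this ⊢; linarith)) n
    have hp : ∀ s : ℂ, DifferentiableAt ℂ (fun b => poch (b + s) n) b := fun s =>
      (differentiable_poch n _).comp (f := fun b : ℂ => b + s) b (by fun_prop)
    refine DifferentiableAt.differentiableWithinAt ?_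
    unfold term
    have := hp (1 / 2)
    have := hp (1 / 4)
    have := hp (3 / 4)
    have := hp 1
    fun_prop (disch := exact pow_ne_zero _ h1)
  · refine (norm_term_le hb.1.le n).trans ?_
    have : ‖b‖ ≤ ‖a‖ + 1 := by simpa using (Metric.mem_ball.1 hb.2).le
    gcongr

/-- The right edge 9/10 of the strip is chosen for this: there (2a + 1/2)/(3/2 - a) is 23/6 < 39/10,
so the factor 1/4 still wins. At Re a = 1 this factorwise bound would already exceed 4. -/
lemma norm_term₂_le {a : ℂ} (ha : a ∈ strip) (n : ℕ) : ‖term₂ a n‖ ≤ (39 / 40) ^ n := by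
  obtain ⟨h1, h2⟩ := ha
  have k1 : ‖poch (a + 1 / 2) n / poch (a + 1) n‖ ≤ 1 ^ n := by
    refine norm_poch_div_le (fun j => ?_) zero_le_one n
    rw [one_mul]
    refine norm_le_norm_of_sq_le ?_
    have : (0 : ℝ) ≤ j := j.cast_nonneg
    norm_num
    nlinarith
  have k2 : ‖poch (2 * a + 1 / 2) n / poch (3 / 2 - a) n‖ ≤ (39 / 10) ^ n := by
    refine norm_poch_div_le (fun j => ?_) (by norm_num) n
    have e : (39 / 10 : ℝ) * ‖3 / 2 - a + j‖ = ‖(39 / 10 : ℝ) * (3 / 2 - a + (j : ℂ))‖ := by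
      rw [norm_mul, Complex.norm_real]; norm_num
    rw [e]
    refine norm_le_norm_of_sq_le ?_
    have : (0 : ℝ) ≤ j := j.cast_nonneg
    have k3 : (2 * a.re + 1 / 2 + j) ^ 2 ≤ (39 / 10 * (3 / 2 - a.re + j)) ^ 2 := by
      refine pow_le_pow_left₀ (by linarith) (by linarith) 2
    norm_num
    norm_num at k3
    nlinarith [sq_nonneg a.im]
  rw [term₂, mul_div_mul_comm, norm_mul, norm_mul]
  have e : ‖(1 / 4 ^ n : ℂ)‖ = (1 / 4) ^ n := by
    rw [← one_div_pow, norm_pow]; norm_num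
  rw [e]
  calc _ ≤ (1 / 4 : ℝ) ^ n * (1 ^ n * (39 / 10) ^ n) := by gcongr
    _ = _ := by rw [← mul_pow, ← mul_pow]; norm_num

lemma differentiableOn_tsum_term₂ : DifferentiableOn ℂ (fun a => ∑' n, term₂ a n) strip := by
  refine Complex.differentiableOn_tsum_of_summable_norm (u := fun n : ℕ => (39 / 40) ^ n)
    (summable_geometric_of_lt_one (by norm_num) (by norm_num)) (fun n b hb => ?_) isOpen_strip
    fun n b hb => norm_term₂_le hb n
  obtain ⟨hb1, hb2⟩ := hb
  have h1 : poch (b + 1) n * poch (3 / 2 - b) n ≠ 0 := mul_ne_zero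
    (poch_ne_zero (add_natCast_ne_zero_of_re_pos (by simp; linarith)) n)
    (poch_ne_zero (add_natCast_ne_zero_of_re_pos (by norm_num; linarith)) n)
  have hp : ∀ t s : ℂ, DifferentiableAt ℂ (fun b => poch (t * b + s) n) b := fun t s =>
    (differentiable_poch n _).comp (f := fun b : ℂ => t * b + s) b (by fun_prop)
  refine DifferentiableAt.differentiableWithinAt ?_
  unfold term₂
  have d1 : DifferentiableAt ℂ (fun b => poch (b + 1 / 2) n) b := by simpa using hp 1 (1 / 2)
  have d2 := hp 2 (1 / 2)
  have d3 : DifferentiableAt ℂ (fun b => poch (b + 1) n) b := by simpa using hp 1 1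
  have d4 : DifferentiableAt ℂ (fun b => poch (3 / 2 - b) n) b := by
    convert hp (-1) (3 / 2) using 3; ring
  exact ((d1.mul d2).div (d3.mul d4) h1).const_mul _

lemma norm_tsum_term₂_le {a : ℂ} (ha : a ∈ strip) : ‖∑' n, term₂ a n‖ ≤ 40 := by
  refine (tsum_of_norm_bounded (hasSum_geometric_of_lt_one (by norm_num) (by norm_num))
    (norm_term₂_le ha)).trans_eq (by norm_num)

lemma norm_g₂_le {a : ℂ} (ha : a ∈ strip) (hi : 1 ≤ |a.im|) : ‖g₂ a‖ ≤ 1920 * ‖a‖ := by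
  have h1 : ‖a‖ ≤ ‖2 * a - 1‖ := by
    refine norm_le_norm_of_sq_le ?_
    have : 1 ≤ a.im ^ 2 := by rw [← sq_abs]; nlinarith
    have h1 := ha.1
    have h2 := ha.2
    norm_num
    nlinarith
  have h0 : 0 < ‖a‖ := norm_pos_iff.2 fun h => by simp [h] at hi; linarith
  rw [g₂, norm_mul, norm_div, norm_mul, norm_pow]
  have : ‖(48 : ℂ)‖ = 48 := by norm_num
  rw [this]
  calc _ ≤ 48 * ‖a‖ ^ 2 / ‖a‖ * 40 := by gcongr; exact norm_tsum_term₂_le ha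
    _ = _ := by field_simp; norm_num

/-! ### The Gamma weight and the cosine. -/

/-- The quotient of Gamma functions that makes the recurrence antiperiodic. -/
def weight (a : ℂ) : ℂ :=
  rising (1 / 2) a * rising (1 / 4) a * rising (3 / 4) a / rising 1 a ^ 3 / 4 ^ a

lemma rising_add_one {x a : ℂ} (h : x + a ≠ 0) : rising x (a + 1) = (x + a) * rising x a := by
  rw [rising, rising, ← add_assoc, Complex.Gamma_add_one _ h, mul_div_assoc]

lemma four_cpow_add_one (a : ℂ) : (4 : ℂ) ^ (a + 1) = 4 ^ a * 4 := by
  rw [Complex.cpow_add _ _ (by norm_num), Complex.cpow_one]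

/-- The sign is what turns solutions of the homogeneous recurrence into antiperiodic, rather than
periodic, functions. -/
lemma weight_add_one {a : ℂ} (h1 : 1 / 2 + a ≠ 0) (h2 : 1 / 4 + a ≠ 0) (h3 : 3 / 4 + a ≠ 0)
    (h4 : 1 + a ≠ 0) : weight (a + 1) = -ratio a * weight a := by
  rw [weight, weight, ratio, rising_add_one h1, rising_add_one h2, rising_add_one h3,
    rising_add_one h4, four_cpow_add_one]
  generalize (4 : ℂ) ^ a = z
  rw [show a + 1 = 1 + a by ring]
  generalize 1 + a = y
  simp only [div_eq_mul_inv, mul_inv, mul_pow]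
  ring

lemma differentiableAt_rising {x a : ℂ} (h : 0 < (x + a).re) :
    DifferentiableAt ℂ (rising x) a := by
  unfold rising
  refine DifferentiableAt.div_const ?_ _
  refine (Complex.differentiableAt_Gamma _ fun m hm => ?_).comp (f := fun a => x + a) a
    (by fun_prop)
  exact add_natCast_ne_zero_of_re_pos h m (by rw [hm]; ring)

lemma rising_ne_zero {x a : ℂ} (hx : 0 < x.re) (h : 0 < (x + a).re) : rising x a ≠ 0 :=
  div_ne_zero (Complex.Gamma_ne_zero_of_re_pos h) (Complex.Gamma_ne_zero_of_re_pos hx)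

lemma differentiableAt_weight {a : ℂ} (h : -1 / 4 < a.re) : DifferentiableAt ℂ weight a := by
  have d : ∀ x : ℂ, 1 / 4 ≤ x.re → DifferentiableAt ℂ (rising x) a := fun x hx =>
    differentiableAt_rising (by simp; linarith)
  have n1 : rising 1 a ≠ 0 := rising_ne_zero (by norm_num) (by simp; linarith)
  have n2 : (4 : ℂ) ^ a ≠ 0 := by simp [Complex.cpow_eq_zero_iff]
  unfold weight
  have := d (1 / 2) (by norm_num)
  have := d (1 / 4) (by norm_num)
  have := d (3 / 4) (by norm_num)
  have := d 1 (by norm_num)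
  have d4 : DifferentiableAt ℂ (fun a : ℂ => (4 : ℂ) ^ a) a :=
    differentiableAt_id.const_cpow (Or.inl (by norm_num))
  refine DifferentiableAt.div ?_ d4 n2
  fun_prop (disch := exact pow_ne_zero _ n1)

/-- `Γ (a + s) / Γ (a + 1)` is bounded on right half-planes. -/
lemma exists_norm_Gamma_div_le {s : ℝ} (h0 : 1 / 4 ≤ s) (h1 : s < 1) :
    ∃ C : ℝ, 0 ≤ C ∧ ∀ a : ℂ, -1 / 8 ≤ a.re →
      ‖Complex.Gamma (s + a) / Complex.Gamma (1 + a)‖ ≤ C := by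
  have hs : 0 < ((1 - s : ℝ) : ℂ).re := by rw [Complex.ofReal_re]; linarith
  have hu : 0 < ((s - 1 / 8 : ℝ) : ℂ).re := by rw [Complex.ofReal_re]; linarith
  -- The quotient is B(s + a, 1 - s)/Γ(1 - s), and on (0, 1] the Beta integrand is dominated by the
  -- one at Re a = -1/8.
  have hint := (Complex.betaIntegral_convergent hu hs).norm
  refine ⟨(∫ x in (0 : ℝ)..1, ‖(x : ℂ) ^ (((s - 1 / 8 : ℝ) : ℂ) - 1) *
    (1 - (x : ℂ)) ^ (((1 - s : ℝ) : ℂ) - 1)‖) / ‖Complex.Gamma (1 - s : ℝ)‖, ?_, fun a ha => ?_⟩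
  · exact div_nonneg (intervalIntegral.integral_nonneg zero_le_one fun _ _ => norm_nonneg _)
      (norm_nonneg _)
  have ha' : 0 < ((s : ℂ) + a).re := by simp; linarith
  have hB := Complex.betaIntegral_eq_Gamma_mul_div _ _ ha' hs
  rw [show (s : ℂ) + a + ((1 - s : ℝ) : ℂ) = 1 + a by push_cast; ring] at hB
  have hG : Complex.Gamma (1 - s : ℝ) ≠ 0 := Complex.Gamma_ne_zero_of_re_pos hs
  have hq : Complex.Gamma (s + a) / Complex.Gamma (1 + a) =
      Complex.betaIntegral (s + a) (1 - s : ℝ) / Complex.Gamma (1 - s : ℝ) := by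
    rw [hB]; field_simp
  rw [hq, norm_div]
  gcongr
  rw [Complex.betaIntegral]
  refine intervalIntegral.norm_integral_le_of_norm_le zero_le_one ?_ hint
  refine Eventually.of_forall fun t ht => ?_
  rw [norm_mul, norm_mul, Complex.norm_cpow_eq_rpow_re_of_pos ht.1,
    Complex.norm_cpow_eq_rpow_re_of_pos ht.1]
  refine mul_le_mul_of_nonneg_right ?_ (norm_nonneg _)
  refine Real.rpow_le_rpow_of_exponent_ge ht.1 ht.2 ?_
  simp
  linarith

lemma exists_norm_weight_le : ∃ C : ℝ, 0 ≤ C ∧ ∀ a : ℂ, -1 / 8 ≤ a.re → ‖weight a‖ ≤ C := by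
  obtain ⟨C₁, h1, k1⟩ := exists_norm_Gamma_div_le (s := 1 / 2) (by norm_num) (by norm_num)
  obtain ⟨C₂, h2, k2⟩ := exists_norm_Gamma_div_le (s := 1 / 4) (by norm_num) (by norm_num)
  obtain ⟨C₃, h3, k3⟩ := exists_norm_Gamma_div_le (s := 3 / 4) (by norm_num) (by norm_num)
  set K := Complex.Gamma 1 ^ 3 /
    (Complex.Gamma (1 / 2) * Complex.Gamma (1 / 4) * Complex.Gamma (3 / 4))
  refine ⟨‖K‖ * (C₁ * C₂ * C₃) * 4, by positivity, fun a ha => ?_⟩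
  have k1 := k1 a ha
  have k2 := k2 a ha
  have k3 := k3 a ha
  push_cast at k1 k2 k3
  have e : weight a = K * (Complex.Gamma (1 / 2 + a) / Complex.Gamma (1 + a) *
      (Complex.Gamma (1 / 4 + a) / Complex.Gamma (1 + a)) *
      (Complex.Gamma (3 / 4 + a) / Complex.Gamma (1 + a))) * (4 ^ a)⁻¹ := by
    simp only [weight, rising, K, div_eq_mul_inv, mul_inv, mul_pow, inv_pow, inv_inv]
    ring
  have e4 : ‖((4 : ℂ) ^ a)⁻¹‖ ≤ 4 := by
    have : ‖(4 : ℂ) ^ a‖ = 4 ^ a.re := by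
      simpa using Complex.norm_cpow_eq_rpow_re_of_pos (x := 4) (by norm_num) a
    rw [norm_inv, this, ← Real.rpow_neg (by norm_num)]
    calc (4 : ℝ) ^ (-a.re) ≤ 4 ^ (1 : ℝ) := by gcongr <;> linarith
      _ = 4 := Real.rpow_one 4
  rw [e, norm_mul, norm_mul, norm_mul, norm_mul]
  gcongr

/-- The reverse triangle inequality for the two exponentials gives |cos πa| ≥ sinh(π|Im a|) ≥ π|Im
a|. -/
lemma one_le_norm_cos {a : ℂ} (h : 1 ≤ |a.im|) : 1 ≤ ‖Complex.cos (Real.pi * a)‖ := by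
  have key : Real.pi * |a.im| ≤ ‖Complex.cos (Real.pi * a)‖ := by
    have h1 : Real.pi * |a.im| ≤ Real.sinh (Real.pi * |a.im|) :=
      Real.self_le_sinh_iff.2 (by positivity)
    have h2 : Real.sinh (Real.pi * |a.im|) ≤ ‖Complex.cos (Real.pi * a)‖ := by
      rw [Complex.cos, norm_div, Complex.norm_two, Real.sinh_eq]
      gcongr
      have n1 : ‖Complex.exp (Real.pi * a * Complex.I)‖ = Real.exp (-(Real.pi * a.im)) := by
        rw [Complex.norm_exp]; simp
      have n2 : ‖Complex.exp (-(Real.pi * a) * Complex.I)‖ = Real.exp (Real.pi * a.im) := by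
        rw [Complex.norm_exp]; simp
      rcases le_total 0 a.im with hi | hi
      · rw [abs_of_nonneg hi, ← n1, ← n2, add_comm]
        exact norm_sub_le_norm_add _ _
      · rw [abs_of_nonpos hi, mul_neg, neg_neg, ← n1, ← n2]
        exact norm_sub_le_norm_add _ _
    exact h1.trans h2
  have := Real.pi_gt_three
  nlinarith

lemma cos_add_one (a : ℂ) :
    Complex.cos (Real.pi * (a + 1)) = -Complex.cos (Real.pi * a) := by
  rw [mul_add, mul_one, Complex.cos_add_pi]

lemma cos_ne_zero_of_mem_strip {a : ℂ} (ha : a ∈ strip) (h : a ≠ 1 / 2) :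
    Complex.cos (Real.pi * a) ≠ 0 := by
  intro hc
  obtain ⟨k, hk⟩ := Complex.cos_eq_zero_iff.1 hc
  have hpi : (Real.pi : ℂ) ≠ 0 := by exact_mod_cast Real.pi_ne_zero
  have e : a = k + 1 / 2 := mul_left_cancel₀ hpi (by rw [hk]; ring)
  have hr : a.re = k + 1 / 2 := by rw [e]; norm_num
  have h1 := ha.1
  have h2 := ha.2
  rw [hr] at h1 h2
  have : k = 0 := by
    have : (-1 : ℝ) < k := by linarith
    have : (k : ℝ) < 1 := by linarith
    have : -1 < k := by exact_mod_cast ‹(-1 : ℝ) < k›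
    have : k < 1 := by exact_mod_cast ‹(k : ℝ) < 1›
    omega
  rw [this] at e
  exact h (by simpa using e)

/-! ### Removing the singularity at 1/2. -/

/-- The function `a ↦ cos (π a)` with its zero at `1 / 2` divided out. -/
def cosSlope : ℂ → ℂ := dslope (fun a : ℂ => Complex.cos (Real.pi * a)) (1 / 2)

lemma hasDerivAt_cos_pi_mul (a : ℂ) :
    HasDerivAt (fun a : ℂ => Complex.cos (Real.pi * a)) (-Complex.sin (Real.pi * a) * Real.pi) a := by
  have := (hasDerivAt_id a).const_mul (Real.pi : ℂ)
  simpa using this.ccos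

lemma cosSlope_half : cosSlope (1 / 2) = -Real.pi := by
  rw [cosSlope, dslope_same, (hasDerivAt_cos_pi_mul _).deriv, mul_one_div, Complex.sin_pi_div_two]
  ring

lemma mul_cosSlope (a : ℂ) : (a - 1 / 2) * cosSlope a = Complex.cos (Real.pi * a) := by
  have := sub_smul_dslope (fun a : ℂ => Complex.cos (Real.pi * a)) (1 / 2) a
  rw [smul_eq_mul] at this
  rw [cosSlope, this, mul_one_div, Complex.cos_pi_div_two, sub_zero]

lemma differentiableOn_cosSlope : DifferentiableOn ℂ cosSlope strip := by
  refine (Complex.differentiableOn_dslope (isOpen_strip.mem_nhds (by norm_num [strip]))).2 ?_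
  exact fun a _ => (hasDerivAt_cos_pi_mul a).differentiableAt.differentiableWithinAt

lemma cosSlope_ne_zero {a : ℂ} (ha : a ∈ strip) : cosSlope a ≠ 0 := by
  rcases eq_or_ne a (1 / 2) with rfl | h
  · rw [cosSlope_half, neg_ne_zero]
    exact_mod_cast Real.pi_ne_zero
  · intro h0
    have := mul_cosSlope a
    rw [h0, mul_zero] at this
    exact cos_ne_zero_of_mem_strip ha h this.symm

/-- The holomorphic version of `cos (π a) (f a - g₂ a) weight a`. -/
def product (a : ℂ) : ℂ := weight a *
  (Complex.cos (Real.pi * a) * f a - 24 * a ^ 2 * cosSlope a * ∑' n, term₂ a n)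

lemma product_eq {a : ℂ} (h : a ≠ 1 / 2) :
    product a = Complex.cos (Real.pi * a) * (weight a * (f a - g₂ a)) := by
  have h' : a - 1 / 2 ≠ 0 := sub_ne_zero.2 h
  have : g₂ a = 24 * a ^ 2 / (a - 1 / 2) * ∑' n, term₂ a n := by
    rw [g₂, show 2 * a - 1 = 2 * (a - 1 / 2) by ring]
    congr 1
    field_simp
    ring
  rw [product, this, ← mul_cosSlope]
  generalize a - 1 / 2 = y at *
  field_simp

lemma strip_subset {a : ℂ} (ha : a ∈ strip) : -1 / 4 < a.re := by
  have := ha.1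
  linarith

lemma differentiableOn_product : DifferentiableOn ℂ product strip := by
  intro a ha
  have d1 := (differentiableAt_weight (strip_subset ha)).differentiableWithinAt (s := strip)
  have d2 := (differentiableAt_f (strip_subset ha)).differentiableWithinAt (s := strip)
  have d3 := differentiableOn_cosSlope a ha
  have d4 := differentiableOn_tsum_term₂ a ha
  have d5 := (hasDerivAt_cos_pi_mul a).differentiableAt.differentiableWithinAt (s := strip)
  unfold product
  exact d1.mul ((d5.mul d2).sub ((((differentiableWithinAt_id.pow 2).const_mul 24).mul d3).mul d4))

lemma Gamma_one_half : Complex.Gamma (1 / 2) = (√Real.pi : ℝ) := by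
  rw [← Real.Gamma_one_half_eq, ← Complex.Gamma_ofReal]; push_cast; rfl

lemma weight_half : weight (1 / 2) = 1 / Real.pi ^ 2 := by
  have hpi : (0 : ℝ) < Real.pi := Real.pi_pos
  have g1 := Gamma_one_half
  have g2 : Complex.Gamma (1 + 1 / 2) = 1 / 2 * ((√Real.pi : ℝ) : ℂ) := by
    rw [add_comm, Complex.Gamma_add_one _ (by norm_num), g1]
  have g3 : Complex.Gamma (3 / 4 + 1 / 2) = 1 / 4 * Complex.Gamma (1 / 4) := by
    rw [← Complex.Gamma_add_one _ (by norm_num)]; norm_num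
  have g4 : Complex.Gamma (1 / 4 + 1 / 2) = Complex.Gamma (3 / 4) := by norm_num
  have g5 : Complex.Gamma (1 / 2 + 1 / 2) = 1 := by norm_num [Complex.Gamma_one]
  have n1 : Complex.Gamma (1 / 4) ≠ 0 := Complex.Gamma_ne_zero_of_re_pos (by norm_num)
  have n2 : Complex.Gamma (3 / 4) ≠ 0 := Complex.Gamma_ne_zero_of_re_pos (by norm_num)
  have n3 : ((√Real.pi : ℝ) : ℂ) ≠ 0 := by exact_mod_cast (Real.sqrt_pos.2 hpi).ne'
  have e4 : (4 : ℂ) ^ (1 / 2 : ℂ) = 2 := by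
    rw [show (4 : ℂ) = 2 ^ 2 by norm_num, one_div]
    exact_mod_cast Complex.pow_cpow_nat_inv (n := 2) (by norm_num) (x := 2)
      (by simp; positivity) (by simp; positivity)
  have hs : (Real.pi : ℂ) = ((√Real.pi : ℝ) : ℂ) ^ 2 := by
    rw [← Complex.ofReal_pow, Real.sq_sqrt hpi.le]
  rw [weight, rising, rising, rising, rising, g1, g2, g3, g4, g5, e4, Complex.Gamma_one, hs]
  field_simp
  norm_num

/-- At a = 1/2 the upper and lower parameters coincide and the series is geometric. -/
lemma tsum_term₂_half : ∑' n, term₂ (1 / 2) n = 4 / 3 := by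
  have : ∀ n, term₂ (1 / 2) n = (1 / 4) ^ n := by
    intro n
    have n1 : poch 1 n ≠ 0 := poch_ne_zero (add_natCast_ne_zero_of_re_pos (by norm_num)) n
    have n2 : poch (3 / 2) n ≠ 0 := poch_ne_zero (add_natCast_ne_zero_of_re_pos (by norm_num)) n
    rw [term₂]
    norm_num
    rw [mul_comm (poch 1 n), div_self (mul_ne_zero n2 n1), mul_one, one_div, inv_pow]
  simp_rw [this]
  rw [tsum_geometric_of_norm_lt_one (by norm_num)]
  norm_num

/-- The origin of the constant 8/π: subtracting this value makes the singularity at 1/2 removable.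
-/
lemma product_half : product (1 / 2) = 8 / Real.pi := by
  have hpi : (Real.pi : ℂ) ≠ 0 := by exact_mod_cast Real.pi_ne_zero
  rw [product, weight_half, tsum_term₂_half, cosSlope_half, mul_one_div, Complex.cos_pi_div_two]
  field_simp
  ring

/-- The difference quotient `(product a - 8 / π) / cos (π a)`. -/
def quotient (a : ℂ) : ℂ := dslope product (1 / 2) a / cosSlope a

lemma half_mem_strip : (1 / 2 : ℂ) ∈ strip := by norm_num [strip]

lemma differentiableOn_quotient : DifferentiableOn ℂ quotient strip :=
  ((Complex.differentiableOn_dslope (isOpen_strip.mem_nhds half_mem_strip)).2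
    differentiableOn_product).div differentiableOn_cosSlope fun _ => cosSlope_ne_zero

lemma quotient_eq {a : ℂ} (ha : a ∈ strip) (h : a ≠ 1 / 2) :
    quotient a = weight a * (f a - g₂ a) - 8 / Real.pi / Complex.cos (Real.pi * a) := by
  have h' : a - 1 / 2 ≠ 0 := sub_ne_zero.2 h
  have hc := cos_ne_zero_of_mem_strip ha h
  rw [quotient, dslope_of_ne _ h, slope_def_field, product_half, product_eq h, div_div, mul_cosSlope,
    sub_div, mul_div_cancel_left₀ _ hc]

lemma sub_g₂_eq {a : ℂ} (ha : ∀ m : ℕ, a + 1 + m ≠ 0)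
    (ha' : ∀ m : ℕ, 1 / 2 - a + m ≠ 0) (h2 : 2 * a + 1 ≠ 0) :
    f a - g₂ a = ratio a * (f (a + 1) - g₂ (a + 1)) := by
  rw [f_eq_add_ratio_mul, g₂_eq_add_ratio_mul ha ha' h2]
  ring

lemma quotient_add_one {a : ℂ} (h1 : -1 / 5 < a.re) (h2 : a.re < -1 / 10) :
    quotient (a + 1) = -quotient a := by
  have m1 : a ∈ strip := ⟨h1, by linarith⟩
  have m2 : a + 1 ∈ strip := ⟨by simp; linarith, by simp; linarith⟩
  have n1 : a ≠ 1 / 2 := fun h => by rw [h] at h2; norm_num at h2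
  have n2 : a + 1 ≠ 1 / 2 := fun h => by
    have := congrArg Complex.re h
    norm_num at this
    linarith
  have e := sub_g₂_eq (a := a) (add_natCast_ne_zero_of_re_pos (by simp; linarith))
    (add_natCast_ne_zero_of_re_pos (by norm_num; linarith))
    (by simpa using add_natCast_ne_zero_of_re_pos (x := 2 * a + 1) (by simp; linarith) 0)
  have p : ∀ x : ℂ, 1 / 4 ≤ x.re → x + a ≠ 0 := fun x hx => by
    simpa using add_natCast_ne_zero_of_re_pos (x := x + a) (by simp; linarith) 0
  rw [quotient_eq m1 n1, quotient_eq m2 n2, cos_add_one, e, weight_add_one (p _ (by norm_num))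
    (p _ (by norm_num)) (p _ (by norm_num)) (p _ (by norm_num))]
  ring

/-- Compactness handles |Im a| ≤ 1, where the singularity was removed. Beyond it the weight and
1/cos are bounded, and `f` and `g₂` grow linearly. -/
lemma exists_norm_quotient_le : ∃ C : ℝ, ∀ a : ℂ, -1 / 8 ≤ a.re → a.re ≤ 7 / 8 →
    ‖quotient a‖ ≤ C * (1 + |a.im|) := by
  have hK : IsCompact (Set.Icc (-1 / 8 : ℝ) (7 / 8) ×ℂ Set.Icc (-1 : ℝ) 1) :=
    isCompact_Icc.reProdIm isCompact_Icc
  obtain ⟨M, hM⟩ := hK.exists_bound_of_continuousOn (f := quotient)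
    (differentiableOn_quotient.continuousOn.mono fun a ha => by
      have h1 := ha.1
      simp only [Set.mem_preimage, Set.mem_Icc] at h1
      exact ⟨by linarith, by linarith⟩)
  obtain ⟨W, hW0, hW⟩ := exists_norm_weight_le
  obtain ⟨F, hF0, hF⟩ := exists_norm_f_le
  have hpi := Real.pi_pos
  refine ⟨max M (W * (2 * F + 1920) + 8 / Real.pi), fun a h1 h2 => ?_⟩
  have hi := abs_nonneg a.im
  rcases le_total |a.im| 1 with h | h
  · have hq := hM a ⟨⟨h1, h2⟩, abs_le.1 h⟩
    have hM0 : 0 ≤ M := (norm_nonneg _).trans hq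
    calc _ ≤ M := hq
      _ ≤ M * (1 + |a.im|) := by nlinarith
      _ ≤ _ := by gcongr; exact le_max_left _ _
  · have ha : a ∈ strip := ⟨by linarith, by linarith⟩
    have hne : a ≠ 1 / 2 := fun h' => by rw [h'] at h; norm_num at h
    have hn : ‖a‖ ≤ 1 + |a.im| := by
      refine (Complex.norm_le_abs_re_add_abs_im a).trans ?_
      have : |a.re| ≤ 1 := abs_le.2 ⟨by linarith, by linarith⟩
      linarith
    have c1 := one_le_norm_cos h
    rw [quotient_eq ha hne]
    have b1 : ‖f a - g₂ a‖ ≤ (2 * F + 1920) * (1 + |a.im|) := by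
      refine (norm_sub_le _ _).trans ?_
      have f1 := hF a (by linarith)
      have f2 := norm_g₂_le ha h
      nlinarith
    have b2 : ‖(8 / Real.pi / Complex.cos (Real.pi * a) : ℂ)‖ ≤ 8 / Real.pi := by
      rw [norm_div]
      have : ‖(8 / Real.pi : ℂ)‖ = 8 / Real.pi := by
        rw [norm_div, Complex.norm_real, Real.norm_of_nonneg hpi.le]; norm_num
      rw [this]
      exact div_le_self (by positivity) c1
    calc _ ≤ ‖weight a * (f a - g₂ a)‖ + ‖(8 / Real.pi / Complex.cos (Real.pi * a) : ℂ)‖ :=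
          norm_sub_le _ _
      _ ≤ W * ((2 * F + 1920) * (1 + |a.im|)) + 8 / Real.pi := by
          rw [norm_mul]
          gcongr
          exact hW a h1
      _ ≤ (W * (2 * F + 1920) + 8 / Real.pi) * (1 + |a.im|) := by
          have : 0 ≤ 8 / Real.pi * |a.im| := by positivity
          nlinarith
      _ ≤ _ := by gcongr; exact le_max_right _ _

/-! ### The second reduction on its full domain. -/

/-- The Gamma quotient in the second reduction. -/
def gammaPart (a : ℂ) : ℂ := 8 / (Real.pi : ℂ) * ((4 : ℂ) ^ a / Complex.cos (Real.pi * a))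
  * (rising 1 a ^ 3 / (rising (1 / 2) a * rising (1 / 4) a * rising (3 / 4) a))

lemma weight_ne_zero {a : ℂ} (h : -1 / 4 < a.re) : weight a ≠ 0 := by
  have d : ∀ x : ℂ, 1 / 4 ≤ x.re → rising x a ≠ 0 := fun x hx =>
    rising_ne_zero (by linarith) (by simp; linarith)
  have n2 : (4 : ℂ) ^ a ≠ 0 := by simp [Complex.cpow_eq_zero_iff]
  exact div_ne_zero (div_ne_zero (mul_ne_zero (mul_ne_zero (d _ (by norm_num)) (d _ (by norm_num)))
    (d _ (by norm_num))) (pow_ne_zero _ (d _ (by norm_num)))) n2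

lemma gammaPart_eq (a : ℂ) :
    gammaPart a = 8 / Real.pi / Complex.cos (Real.pi * a) / weight a := by
  simp only [gammaPart, weight, div_eq_mul_inv, mul_inv, inv_inv]
  ring

lemma f_eq_of_mem_strip {a : ℂ} (ha : a ∈ strip) (h : a ≠ 1 / 2) : f a = gammaPart a + g₂ a := by
  obtain ⟨C, hC⟩ := exists_norm_quotient_le
  have h0 := eq_zero_of_antiperiodic_on_strip differentiableOn_quotient
    (fun a => quotient_add_one) hC ha
  rw [quotient_eq ha h, sub_eq_zero] at h0
  rw [gammaPart_eq, ← h0, mul_div_cancel_left₀ _ (weight_ne_zero (strip_subset ha))]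
  ring

/-- No condition on x + a is needed, because 1/Γ satisfies its functional equation everywhere, with
value 0 at the poles of Γ. -/
lemma inv_rising_eq {x a : ℂ} : (x + a) * (rising x (a + 1))⁻¹ = (rising x a)⁻¹ := by
  have := Complex.one_div_Gamma_eq_self_mul_one_div_Gamma_add_one (x + a)
  rw [rising, rising, inv_div, inv_div, div_eq_mul_inv, div_eq_mul_inv, this, ← add_assoc]
  ring

lemma gammaPart_eq_ratio_mul {a : ℂ} (h : 1 + a ≠ 0) :
    gammaPart a = ratio a * gammaPart (a + 1) := by
  have r : ∀ x, rising x a = ((x + a) * (rising x (a + 1))⁻¹)⁻¹ := fun x => by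
    rw [inv_rising_eq, inv_inv]
  simp only [gammaPart, cos_add_one, four_cpow_add_one, rising_add_one h]
  rw [r (1 / 2), r (1 / 4), r (3 / 4), ratio, add_comm a 1]
  generalize rising (1 / 2) (1 + a) = x
  generalize rising (1 / 4) (1 + a) = y
  generalize rising (3 / 4) (1 + a) = z
  simp only [div_eq_mul_inv, mul_inv, inv_inv, inv_neg]
  field_simp
  ring

theorem f_eq_gammaPart_add {a : ℂ} (ha : ∀ m : ℕ, a ≠ -((m : ℂ) + 1))
    (hc : Complex.cos (Real.pi * a) ≠ 0) : f a = gammaPart a + g₂ a := by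
  have step : ∀ {b : ℂ}, (∀ m : ℕ, b ≠ -((m : ℂ) + 1)) → Complex.cos (Real.pi * b) ≠ 0 →
      f b - gammaPart b - g₂ b = ratio b * (f (b + 1) - gammaPart (b + 1) - g₂ (b + 1)) := by
    intro b hb hcb
    have hne := ne_of_cos_ne_zero hcb
    have hb' := add_natCast_ne_zero hb
    have e := sub_g₂_eq (a := b) hb'
      (fun m h => hne m (by push_cast; linear_combination -h))
      (fun h => hne (-1) (by push_cast; linear_combination h / 2))
    have e' := gammaPart_eq_ratio_mul (a := b) (by simpa [add_comm] using hb' 0)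
    linear_combination e - e'
  -- To the right the recurrence is used at b - 1 and divided by `ratio (b - 1)`, which is nonzero
  -- there.
  have up : ∀ n : ℕ, ∀ b : ℂ, -1 / 8 ≤ b.re → b.re < n + 7 / 8 → Complex.cos (Real.pi * b) ≠ 0 →
      f b - gammaPart b - g₂ b = 0 := by
    intro n
    induction n with
    | zero =>
      intro b h1 h2 h3
      have hb : b ∈ strip := ⟨by linarith, by norm_num at h2; linarith⟩
      have hne : b ≠ 1 / 2 := by simpa using ne_of_cos_ne_zero h3 0
      rw [f_eq_of_mem_strip hb hne]
      ring
    | succ n ih =>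
      intro b h1 h2 h3
      push_cast at h2
      rcases lt_or_ge b.re (n + 7 / 8) with h4 | h4
      · exact ih b h1 h4 h3
      have hn : (0 : ℝ) ≤ n := n.cast_nonneg
      have hr : -1 / 8 ≤ (b - 1).re := by simp; linarith
      have h5 : Complex.cos (Real.pi * (b - 1)) ≠ 0 := by
        intro h0
        have := cos_add_one (b - 1)
        rw [sub_add_cancel, h0, neg_zero] at this
        exact h3 this
      have h6 := ih (b - 1) hr (by simp; linarith) h5
      have p : ∀ x : ℝ, 1 / 4 ≤ x → b - 1 + x ≠ 0 := fun x hx => by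
        simpa using add_natCast_ne_zero_of_re_pos (x := b - 1 + x)
          (by simp only [Complex.add_re, Complex.ofReal_re]; linarith) 0
      have h7 := step (b := b - 1) (fun m h => p (m + 1) (by
        have : (0 : ℝ) ≤ m := m.cast_nonneg
        linarith) (by rw [h]; push_cast; ring)) h5
      rw [h6, sub_add_cancel] at h7
      refine (mul_eq_zero.1 h7.symm).resolve_left ?_
      have p1 := p (1 / 2) (by norm_num)
      have p2 := p (1 / 4) (by norm_num)
      have p3 := p (3 / 4) (by norm_num)
      have p4 := p 1 (by norm_num)
      push_cast at p1 p2 p3 p4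
      exact div_ne_zero (mul_ne_zero (by norm_num) (mul_ne_zero (mul_ne_zero p1 p2) p3))
        (pow_ne_zero _ p4)
  -- To the left no division is needed: vanishing at b + 1 gives vanishing at b.
  have down : ∀ n : ℕ, ∀ b : ℂ, -1 / 8 ≤ b.re + n → (∀ m : ℕ, b ≠ -((m : ℂ) + 1)) →
      Complex.cos (Real.pi * b) ≠ 0 → f b - gammaPart b - g₂ b = 0 := by
    intro n
    induction n with
    | zero =>
      intro b h1 _ h3
      obtain ⟨N, hN⟩ := exists_nat_gt b.re
      exact up N b (by simpa using h1) (by linarith) h3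
    | succ n ih =>
      intro b h1 h2 h3
      push_cast at h1
      rw [step h2 h3, ih (b + 1) (by simp; linarith)
        (fun m h => h2 (m + 1) (by push_cast; linear_combination h))
        (by rw [cos_add_one]; exact neg_ne_zero.2 h3), mul_zero]
  obtain ⟨n, hn⟩ := exists_nat_gt (-a.re)
  linear_combination down n a (by linarith) ha hc

theorem f_zero : f 0 = ((8 / Real.pi : ℝ) : ℂ) := by
  have h : f 0 = gammaPart 0 + g₂ 0 :=
    f_eq_of_mem_strip (by norm_num [strip]) (by norm_num)
  have hr : ∀ x : ℂ, 0 < x.re → rising x 0 = 1 := fun x hx => by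
    rw [rising, add_zero, div_self (Complex.Gamma_ne_zero_of_re_pos hx)]
  rw [h, gammaPart, g₂, hr _ (by norm_num), hr _ (by norm_num), hr _ (by norm_num),
    hr _ (by norm_num)]
  simp

/-! ### Second-order expansions at 0. -/

/-- `F` is analytic at `0` with the given value, first and second derivative there. -/
structure HasJet (F : ℂ → ℂ) (c₀ c₁ c₂ : ℂ) : Prop where
  analyticAt : AnalyticAt ℂ F 0
  apply_zero : F 0 = c₀
  deriv_zero : deriv F 0 = c₁
  deriv_deriv_zero : deriv (deriv F) 0 = c₂

namespace HasJet

variable {F G : ℂ → ℂ} {a₀ a₁ a₂ b₀ b₁ b₂ : ℂ}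

lemma of_analyticAt (h : AnalyticAt ℂ F 0) : HasJet F (F 0) (deriv F 0) (deriv (deriv F) 0) :=
  ⟨h, rfl, rfl, rfl⟩

lemma of_hasDerivAt {F' : ℂ → ℂ} (h : ∀ a, HasDerivAt F (F' a) a) (h' : HasDerivAt F' a₂ 0) :
    HasJet F (F 0) (F' 0) a₂ := by
  have e : deriv F = F' := funext fun a => (h a).deriv
  have hd : Differentiable ℂ F := fun a => (h a).differentiableAt
  exact ⟨hd.analyticAt 0, rfl, (h 0).deriv, by rw [e]; exact h'.deriv⟩

lemma const (c : ℂ) : HasJet (fun _ => c) c 0 0 :=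
  of_hasDerivAt (fun _ => hasDerivAt_const _ _) (hasDerivAt_const _ _)

lemma congr (h : HasJet F a₀ a₁ a₂) (e : F =ᶠ[𝓝 0] G) : HasJet G a₀ a₁ a₂ :=
  ⟨h.1.congr e, e.eq_of_nhds ▸ h.2, e.deriv_eq ▸ h.3, e.deriv.deriv_eq ▸ h.4⟩

lemma unique (h : HasJet F a₀ a₁ a₂) (h' : HasJet F b₀ b₁ b₂) : a₀ = b₀ ∧ a₁ = b₁ ∧ a₂ = b₂ :=
  ⟨h.2.symm.trans h'.2, h.3.symm.trans h'.3, h.4.symm.trans h'.4⟩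

lemma add (h : HasJet F a₀ a₁ a₂) (h' : HasJet G b₀ b₁ b₂) :
    HasJet (fun a => F a + G a) (a₀ + b₀) (a₁ + b₁) (a₂ + b₂) := by
  have e : deriv (fun a => F a + G a) =ᶠ[𝓝 0] fun a => deriv F a + deriv G a := by
    filter_upwards [h.1.eventually_analyticAt, h'.1.eventually_analyticAt] with a h1 h2
    exact (h1.differentiableAt.hasDerivAt.add h2.differentiableAt.hasDerivAt).deriv
  refine ⟨h.1.add h'.1, by rw [h.2, h'.2], by rw [e.eq_of_nhds, h.3, h'.3], ?_⟩
  rw [e.deriv_eq, ← h.4, ← h'.4]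
  exact (h.1.deriv.differentiableAt.hasDerivAt.add h'.1.deriv.differentiableAt.hasDerivAt).deriv

lemma mul (h : HasJet F a₀ a₁ a₂) (h' : HasJet G b₀ b₁ b₂) :
    HasJet (fun a => F a * G a) (a₀ * b₀) (a₁ * b₀ + a₀ * b₁)
      (a₂ * b₀ + 2 * (a₁ * b₁) + a₀ * b₂) := by
  have e : deriv (fun a => F a * G a) =ᶠ[𝓝 0] fun a => deriv F a * G a + F a * deriv G a := by
    filter_upwards [h.1.eventually_analyticAt, h'.1.eventually_analyticAt] with a h1 h2
    exact (h1.differentiableAt.hasDerivAt.mul h2.differentiableAt.hasDerivAt).deriv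
  refine ⟨h.1.mul h'.1, by rw [h.2, h'.2], by rw [e.eq_of_nhds, h.2, h'.2, h.3, h'.3], ?_⟩
  rw [e.deriv_eq]
  have d1 := h.1.differentiableAt.hasDerivAt
  have d2 := h'.1.differentiableAt.hasDerivAt
  have d3 := h.1.deriv.differentiableAt.hasDerivAt
  have d4 := h'.1.deriv.differentiableAt.hasDerivAt
  rw [h.3] at d1
  rw [h'.3] at d2
  rw [h.4] at d3
  rw [h'.4] at d4
  have := ((d3.mul d2).add (d1.mul d4)).deriv
  rw [h.2, h'.2, h.3, h'.3] at this
  refine Eq.trans this ?_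
  ring

lemma comp_mul_left (h : HasJet F a₀ a₁ a₂) (c : ℂ) :
    HasJet (fun a => F (c * a)) a₀ (c * a₁) (c ^ 2 * a₂) := by
  have e : deriv (fun a => F (c * a)) = fun a => c * deriv F (c * a) :=
    funext fun a => by simpa using deriv_comp_mul_left c F a
  refine ⟨?_, by rw [mul_zero, h.2], by simp only [e, mul_zero, h.3], ?_⟩
  · refine AnalyticAt.fun_comp (f := fun a => c * a) ?_ (by fun_prop)
    rw [mul_zero]; exact h.1
  · rw [e, deriv_const_mul_field, deriv_comp_mul_left, mul_zero, h.4, smul_eq_mul]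
    ring

end HasJet

lemma hasJet_exp (c : ℂ) : HasJet (fun a => Complex.exp (c * a)) 1 c (c ^ 2) := by
  have h : HasJet Complex.exp 1 1 1 := by
    simpa using HasJet.of_hasDerivAt Complex.hasDerivAt_exp (Complex.hasDerivAt_exp 0)
  simpa using h.comp_mul_left c

lemma hasJet_cos : HasJet (fun a => Complex.cos (Real.pi * a)) 1 0 (-Real.pi ^ 2) := by
  have h : HasJet Complex.cos 1 0 (-1) := by
    simpa using HasJet.of_hasDerivAt Complex.hasDerivAt_cos (Complex.hasDerivAt_sin 0).neg
  simpa using h.comp_mul_left Real.pi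

lemma two_cpow (z : ℂ) : (2 : ℂ) ^ z = Complex.exp (Real.log 2 * z) := by
  rw [Complex.cpow_def_of_ne_zero two_ne_zero, Complex.ofReal_log (by norm_num)]
  norm_num

lemma four_cpow (z : ℂ) : (4 : ℂ) ^ z = Complex.exp (2 * Real.log 2 * z) := by
  rw [Complex.cpow_def_of_ne_zero (by norm_num)]
  have : Complex.log 4 = 2 * Real.log 2 := by
    rw [show (4 : ℂ) = ((2 ^ 2 : ℝ) : ℂ) by norm_num, ← Complex.ofReal_log (by norm_num),
      Real.log_pow]
    push_cast; rfl
  rw [this]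

lemma analyticAt_Gamma_add {x : ℂ} (hx : 0 < x.re) :
    AnalyticAt ℂ (fun a => Complex.Gamma (x + a)) 0 := by
  rw [Complex.analyticAt_iff_eventually_differentiableAt]
  have hU : {a : ℂ | -x.re < a.re} ∈ 𝓝 (0 : ℂ) := (isOpen_re_gt _).mem_nhds (by simpa using hx)
  filter_upwards [hU] with a ha
  have hp : 0 < (x + a).re := by
    have : -x.re < a.re := ha
    simp; linarith
  refine (Complex.differentiableAt_Gamma _ fun m hm => ?_).comp (f := fun a => x + a) a
    (by fun_prop)
  exact add_natCast_ne_zero_of_re_pos hp m (by rw [hm]; ring)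

lemma Gamma_half_add_mul_Gamma_one_add (a : ℂ) :
    Complex.Gamma (1 / 2 + a) * Complex.Gamma (1 + a) =
      (√Real.pi : ℝ) * (Complex.Gamma (1 + 2 * a) * Complex.exp (-2 * Real.log 2 * a)) := by
  have h := Complex.Gamma_mul_Gamma_add_half (1 / 2 + a)
  rw [show 1 / 2 + a + 1 / 2 = 1 + a by ring, show 2 * (1 / 2 + a) = 1 + 2 * a by ring,
    show 1 - (1 + 2 * a) = -2 * a by ring, two_cpow] at h
  rw [h]
  ring_nf

lemma Gamma_half_add_mul_Gamma_half_sub {a : ℂ} (hc : Complex.cos (Real.pi * a) ≠ 0) :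
    Complex.Gamma (1 / 2 + a) * Complex.Gamma (1 / 2 + -1 * a) * Complex.cos (Real.pi * a) =
      Real.pi := by
  have h := Complex.Gamma_mul_Gamma_one_sub (1 / 2 + a)
  rw [show 1 - (1 / 2 + a) = 1 / 2 + -1 * a by ring,
    show (Real.pi : ℂ) * (1 / 2 + a) = Real.pi * a + Real.pi / 2 by ring, Complex.sin_add_pi_div_two] at h
  rw [h, div_mul_cancel₀ _ hc]

lemma Gamma_quarter_add (a : ℂ) :
    Complex.Gamma (1 / 4 + a) * Complex.Gamma (3 / 4 + a) =
      Complex.Gamma (1 / 2 + 2 * a) * Complex.exp (-2 * Real.log 2 * a) *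
        (2 ^ (1 / 2 : ℂ) * (√Real.pi : ℝ)) := by
  have h := Complex.Gamma_mul_Gamma_add_half (1 / 4 + a)
  rw [show 1 / 4 + a + 1 / 2 = 3 / 4 + a by ring, show 2 * (1 / 4 + a) = 1 / 2 + 2 * a by ring,
    show 1 - (1 / 2 + 2 * a) = 1 / 2 + -2 * a by ring, Complex.cpow_add _ _ two_ne_zero,
    two_cpow (-2 * a)] at h
  rw [h]
  ring_nf

/-- Duplication merges the quarter arguments into Γ(1/2 + 2a), so only Γ near 1 and near 1/2 has to
be expanded. -/
lemma gammaPart_mul_eq {a : ℂ} (ha : -1 / 4 < a.re) (hc : Complex.cos (Real.pi * a) ≠ 0) :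
    gammaPart a * (Complex.cos (Real.pi * a) *
      (Complex.Gamma (1 / 2 + a) * Complex.Gamma (1 / 2 + 2 * a))) =
      8 * (Complex.exp (4 * Real.log 2 * a) *
        (Complex.Gamma (1 + a) * (Complex.Gamma (1 + a) * Complex.Gamma (1 + a)))) := by
  have hpi : (0 : ℝ) < Real.pi := Real.pi_pos
  have hpi' : (Real.pi : ℂ) ≠ 0 := by exact_mod_cast hpi.ne'
  have n3 : ((√Real.pi : ℝ) : ℂ) ≠ 0 := by exact_mod_cast (Real.sqrt_pos.2 hpi).ne'
  have hs : ((√Real.pi : ℝ) : ℂ) ^ 2 = Real.pi := by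
    rw [← Complex.ofReal_pow, Real.sq_sqrt hpi.le]
  have n4 : (2 : ℂ) ^ (1 / 2 : ℂ) ≠ 0 := by simp [Complex.cpow_eq_zero_iff]
  have h0 := Gamma_quarter_add 0
  have h1 := Gamma_quarter_add a
  have g1 : Complex.Gamma (1 / 2 + a) ≠ 0 :=
    Complex.Gamma_ne_zero_of_re_pos (by norm_num; linarith)
  have g2 : Complex.Gamma (1 / 2 + 2 * a) ≠ 0 :=
    Complex.Gamma_ne_zero_of_re_pos (by norm_num; linarith)
  simp only [add_zero, mul_zero, Complex.exp_zero, mul_one, Gamma_one_half] at h0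
  have e : rising (1 / 2) a * rising (1 / 4) a * rising (3 / 4) a =
      Complex.Gamma (1 / 2 + a) * Complex.Gamma (1 / 2 + 2 * a) *
        Complex.exp (-2 * Real.log 2 * a) / Real.pi := by
    have : rising (1 / 2) a * rising (1 / 4) a * rising (3 / 4) a =
      Complex.Gamma (1 / 2 + a) * (Complex.Gamma (1 / 4 + a) * Complex.Gamma (3 / 4 + a)) /
        (Complex.Gamma (1 / 2) * (Complex.Gamma (1 / 4) * Complex.Gamma (3 / 4))) := by
      simp only [rising, div_eq_mul_inv, mul_inv]; ring
    rw [this, h0, h1, Gamma_one_half, ← hs]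
    field_simp
  have e4 : Complex.exp (4 * Real.log 2 * a) * Complex.exp (-2 * Real.log 2 * a) =
      Complex.exp (2 * Real.log 2 * a) := by
    rw [← Complex.exp_add]; ring_nf
  have n5 := Complex.exp_ne_zero (-2 * Real.log 2 * a)
  rw [gammaPart, e, four_cpow, ← e4, rising, Complex.Gamma_one, div_one]
  generalize Complex.Gamma (1 / 2 + a) = x at *
  generalize Complex.Gamma (1 / 2 + 2 * a) = y at *
  field_simp

lemma eventually_re_gt : ∀ᶠ a : ℂ in 𝓝 0, -1 / 4 < a.re :=
  (isOpen_re_gt _).mem_nhds (by norm_num)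

lemma eventually_mem_strip : ∀ᶠ a : ℂ in 𝓝 0, a ∈ strip :=
  isOpen_strip.mem_nhds (by norm_num [strip])

lemma eventually_ne_half : ∀ᶠ a : ℂ in 𝓝 0, a ≠ 1 / 2 :=
  isOpen_ne.mem_nhds (by norm_num)

lemma eventually_differentiableAt_f : ∀ᶠ a : ℂ in 𝓝 0, DifferentiableAt ℂ f a := by
  filter_upwards [eventually_re_gt] with a ha using differentiableAt_f ha

/-- Because of the factor a², only the value of the series at 0 matters: 2 · (-48) · π/3. -/
lemma hasJet_g₂ : HasJet g₂ 0 0 (-32 * Real.pi) := by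
  have hA : AnalyticAt ℂ (fun a => 48 / (2 * a - 1) * ∑' n, term₂ a n) 0 := by
    rw [Complex.analyticAt_iff_eventually_differentiableAt]
    filter_upwards [eventually_mem_strip, eventually_ne_half] with a ha hne
    have hne' : 2 * a - 1 ≠ 0 := fun h => hne (by linear_combination h / 2)
    have := differentiableOn_tsum_term₂.differentiableAt (isOpen_strip.mem_nhds ha)
    refine DifferentiableAt.mul ?_ this
    fun_prop (disch := exact hne')
  have h2 : HasJet (fun a : ℂ => a ^ 2) 0 0 2 := by
    have := HasJet.of_hasDerivAt (F := fun a : ℂ => a ^ 2) (F' := fun a => 2 * a) (a₂ := 2)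
      (fun a => by simpa using hasDerivAt_pow 2 a) (by simpa using (hasDerivAt_id (0 : ℂ)).const_mul 2)
    simpa using this
  have h := h2.mul (HasJet.of_analyticAt hA)
  have e : (fun a : ℂ => a ^ 2 * (48 / (2 * a - 1) * ∑' n, term₂ a n)) = g₂ := by
    funext a; rw [g₂]; ring
  rw [e, tsum_term₂_zero] at h
  convert h using 1 <;> norm_num
  ring

theorem hasJet_f : HasJet f (8 / Real.pi) (80 / Real.pi * Real.log 2)
    (8 / Real.pi * (100 * Real.log 2 ^ 2 - 5 * Real.pi ^ 2)) := by
  have hpi : (0 : ℝ) < Real.pi := Real.pi_pos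
  have hpi' : (Real.pi : ℂ) ≠ 0 := by exact_mod_cast hpi.ne'
  have hs : ((√Real.pi : ℝ) : ℂ) ^ 2 = Real.pi := by
    rw [← Complex.ofReal_pow, Real.sq_sqrt hpi.le]
  have n3 : ((√Real.pi : ℝ) : ℂ) ≠ 0 := by exact_mod_cast (Real.sqrt_pos.2 hpi).ne'
  have hg := hasJet_g₂
  have hf := HasJet.of_analyticAt
    (Complex.analyticAt_iff_eventually_differentiableAt.2 eventually_differentiableAt_f)
  have hH := hf.add (hg.mul (HasJet.const (-1)))
  have hA := HasJet.of_analyticAt (analyticAt_Gamma_add (x := 1) (by norm_num))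
  have hB := HasJet.of_analyticAt (analyticAt_Gamma_add (x := 1 / 2) (by norm_num))
  rw [add_zero, Complex.Gamma_one] at hA
  rw [add_zero, Gamma_one_half] at hB
  set α₁ := deriv (fun a => Complex.Gamma (1 + a)) 0
  set α₂ := deriv (deriv (fun a => Complex.Gamma (1 + a))) 0
  set β₁ := deriv (fun a => Complex.Gamma (1 / 2 + a)) 0
  set β₂ := deriv (deriv (fun a => Complex.Gamma (1 / 2 + a))) 0
  set L : ℂ := ((Real.log 2 : ℝ) : ℂ)
  set s : ℂ := ((√Real.pi : ℝ) : ℂ)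
  have ev : ∀ᶠ a : ℂ in 𝓝 0, Complex.cos (Real.pi * a) ≠ 0 := by
    filter_upwards [eventually_mem_strip, eventually_ne_half] with a using cos_ne_zero_of_mem_strip
  -- Duplication expresses the derivatives of Γ at 1/2 through those at 1.
  obtain ⟨-, d1, d2⟩ := (hB.mul hA).unique ((((HasJet.const s).mul
    ((hA.comp_mul_left 2).mul (hasJet_exp (-2 * L)))).congr (Eventually.of_forall fun a =>
      (Gamma_half_add_mul_Gamma_one_add a).symm)))
  -- By reflection this product is constant; its vanishing second derivative will give Γ''(1) =
  -- Γ'(1)² + π²/6.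
  obtain ⟨-, -, r2⟩ := (((hB.mul (hB.comp_mul_left (-1))).mul hasJet_cos).congr
    (ev.mono fun a => Gamma_half_add_mul_Gamma_half_sub)).unique (HasJet.const _)
  have hT := (hH.mul (hasJet_cos.mul (hB.mul (hB.comp_mul_left 2)))).congr (G := fun a =>
    8 * (Complex.exp (4 * L * a) *
        (Complex.Gamma (1 + a) * (Complex.Gamma (1 + a) * Complex.Gamma (1 + a))))) (by
    filter_upwards [ev, eventually_mem_strip, eventually_ne_half] with a hc ha hne
    rw [← gammaPart_mul_eq (strip_subset ha) hc, f_eq_of_mem_strip ha hne]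
    ring)
  obtain ⟨t0, t1, t2⟩ := hT.unique ((HasJet.const 8).mul
    ((hasJet_exp (4 * L)).mul (hA.mul (hA.mul hA))))
  have b1 : β₁ = s * (α₁ - 2 * L) := by linear_combination d1
  have b2 : β₂ = s * (3 * α₂ - 4 * L * α₁ + 4 * L ^ 2 - 2 * α₁ ^ 2) := by
    rw [b1] at d2
    linear_combination d2
  rw [b1, b2] at r2 t2
  rw [b1] at t1
  have a2 : α₂ = α₁ ^ 2 + Real.pi ^ 2 / 6 := by
    have : (6 * s ^ 2) * (α₂ - (α₁ ^ 2 + Real.pi ^ 2 / 6)) = 0 := by linear_combination r2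
    exact sub_eq_zero.1 ((mul_eq_zero.1 this).resolve_left
      (mul_ne_zero (by norm_num) (pow_ne_zero _ n3)))
  rw [a2] at t2
  have f0 : f 0 = 8 / Real.pi := by rw [f_zero]; push_cast; rfl
  have hu : f 0 * s ^ 2 = 8 := by rw [f0, hs]; field_simp
  -- The unevaluated α₁ = Γ'(1) cancels here and in the second derivative.
  have h1 : s ^ 2 * deriv f 0 = 80 * L := by
    linear_combination t1 - 3 * (α₁ - 2 * L) * hu
  have h2 : s ^ 2 * deriv (deriv f) 0 = 8 * (100 * L ^ 2 - 5 * Real.pi ^ 2) := by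
    linear_combination t2 - 6 * (α₁ - 2 * L) * h1 - (-Real.pi ^ 2 + 4 * (α₁ - 2 * L) ^ 2 +
      5 * (α₁ ^ 2 + Real.pi ^ 2 / 2 - 4 * L * α₁ + 4 * L ^ 2)) * hu - 32 * Real.pi * hs
  have f1 : deriv f 0 = 80 / Real.pi * L := by
    rw [hs] at h1; field_simp; linear_combination h1
  have f2 : deriv (deriv f) 0 = 8 / Real.pi * (100 * L ^ 2 - 5 * Real.pi ^ 2) := by
    rw [hs] at h2; field_simp; linear_combination h2
  rw [f0, f1, f2] at hf
  exact hf

end RamanujanExt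

end

theorem mainTheorem4 :
    -- the series `f` converges wherever its terms are defined
    (∀ a : ℂ, (∀ m : ℕ, a ≠ -((m : ℂ) + 1)) → Summable (RamanujanExt.term a)) ∧
    -- the first reduction
    (∀ a : ℂ, 0 < a.re →
      Summable (RamanujanExt.term₁ a) ∧
      RamanujanExt.f a = 16 * a * ∑' n : ℕ, RamanujanExt.term₁ a n) ∧
    -- the second reduction
    (∀ a : ℂ, (∀ m : ℕ, a ≠ -((m : ℂ) + 1)) → Complex.cos (Real.pi * a) ≠ 0 →
      Summable (RamanujanExt.term₂ a) ∧
      RamanujanExt.f a =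
        8 / (Real.pi : ℂ) * ((4 : ℂ) ^ a / Complex.cos (Real.pi * a))
            * (RamanujanExt.rising 1 a ^ 3
                / (RamanujanExt.rising (1 / 2) a * RamanujanExt.rising (1 / 4) a
                    * RamanujanExt.rising (3 / 4) a))
          + 48 * a ^ 2 / (2 * a - 1) * ∑' n : ℕ, RamanujanExt.term₂ a n) ∧
    -- the special values
    RamanujanExt.f (1 / 2) = ((16 * Real.log 2 : ℝ) : ℂ) ∧
    RamanujanExt.f 0 = ((8 / Real.pi : ℝ) : ℂ) ∧
    (∀ᶠ a in nhds (0 : ℂ), DifferentiableAt ℂ RamanujanExt.f a) ∧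
    HasDerivAt RamanujanExt.f ((80 / Real.pi * Real.log 2 : ℝ) : ℂ) 0 ∧
    HasDerivAt (deriv RamanujanExt.f)
      ((8 / Real.pi * (100 * Real.log 2 ^ 2 - 5 * Real.pi ^ 2) : ℝ) : ℂ) 0 := by
  refine ⟨fun a _ => RamanujanExt.summable_term a,
    fun a ha => ⟨RamanujanExt.summable_term₁ ha, RamanujanExt.f_eq_g₁ ha⟩,
    fun a ha hc => ⟨RamanujanExt.summable_term₂ a, RamanujanExt.f_eq_gammaPart_add ha hc⟩,
    RamanujanExt.f_one_half, RamanujanExt.f_zero, RamanujanExt.eventually_differentiableAt_f, ?_, ?_⟩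
  · have h := RamanujanExt.hasJet_f
    have := h.1.differentiableAt.hasDerivAt
    rw [h.3] at this
    exact_mod_cast this
  · have h := RamanujanExt.hasJet_f
    have := h.1.deriv.differentiableAt.hasDerivAt
    rw [h.4] at this
    exact_mod_cast this
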